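/- Bilevel Independent Set, variant $(\mathrm c_s,\mathrm d_b,\mathsf p)$. An instance consists of a simple graph $G=(V,E)$ with vertex set $V=\{0,\dots,n-1\}$, $n\ge 1$, a partition $V=V_\ell\,\dot\cup\,V_f$ into the leader's and the follower's vertices, and nonnegative weights $w_\ell,w_f\colon V\to\mathbb R_{\ge 0}$. Put $\mathrm c_s(S)=\sum_{v\in S}w_\ell(v)$ and $\mathrm d_b(S)=\min_{v\in S}w_f(v)$. For $L\subseteq V_\ell$, a set $F\subseteq V_f$ is a suitable reaction if $L\cup F$ is a nonempty independent set of $G$; it is a possible reaction if moreover $\mathrm d_b(L\cup F)$ is maximum among all suitable reactions to $L$; and it is an optimal (pessimistic) reaction if moreover $\mathrm c_s(L\cup F)$ is minimum among all possible reactions to $L$. The leader seeks an optimal action, that is, a set $L\subseteq V_\ell$ with an optimal pessimistic reaction $F_L$ such that $\mathrm c_s(L\cup F_L)$ is maximum over all $L\subseteq V_\ell$ to which a suitable reaction exists. Theorem. On bipartite graphs this problem is solvable in polynomial time: there is one algorithm that, for every such instance with $G$ bipartite (given by the number $n$, the adjacency matrix, $V_\ell$, $w_\ell$ and $w_f$;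 no bipartition of $G$ is supplied), halts with $L\cup F_L$ for an optimal action $L$ and an optimal pessimistic reaction $F_L$ to it, and with the optimal value $\mathrm c_s(L\cup F_L)$. The algorithm is a fixed program of a random access machine whose natural-number cells can be copied, added, subtracted (truncated at $0$) and compared and used as addresses, and whose weight cells can only be copied, added, subtracted and compared. (i) For real weights, the number of its elementary operations, each at unit cost, is at most $p(n)$ for a fixed polynomial $p$. (ii) For rational weights, its logarithmic (bit) cost, in which each operation is charged by the binary length of the number it produces, is at most $q(N)$ for a fixed polynomial $q$, where $N$ is $n$ plus the total binary length of all the weights. Moreover, for every such instance with real weights and $G$ bipartite, every optimal action of the leader is either $\emptyset$ or an independent subset of $V_\ell$ of maximum weight with respect to $w_\ell$ among the independent subsets of $V_\ell$; and for every nonempty independent set $M\subseteq V_\ell$ of maximum $w_\ell$-weight among these, $\emptyset$ or $M$ is an optimal action of the leader. -/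

import Mathlib

/-! ### Bilevel Independent Set: sum leader, bottleneck follower, pessimistic follower -/

/-- An instance of Bilevel Independent Set on the vertex set `Fin n`, with nonnegative weights
in the ordered field `K`.  The leader controls `leader`, the follower its complement. -/
structure BISInstance (K : Type) [Field K] [LinearOrder K] [IsStrictOrderedRing K] (n : ℕ) where
  graph : SimpleGraph (Fin n)
  leader : Finset (Fin n)
  leaderWeight : Fin n → K
  followerWeight : Fin n → K
  leaderWeight_nonneg : ∀ v, 0 ≤ leaderWeight v
  followerWeight_nonneg : ∀ v, 0 ≤ followerWeight v

namespace BISInstance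

variable {K : Type} [Field K] [LinearOrder K] [IsStrictOrderedRing K] {n : ℕ}

/-- The sum objective of the leader. -/
def leaderObjective (I : BISInstance K n) (S : Finset (Fin n)) : K :=
  ∑ v ∈ S, I.leaderWeight v

/-- The bottleneck objective of the follower; the minimum over the empty set is `∞`. -/
def followerObjective (I : BISInstance K n) (S : Finset (Fin n)) : WithTop K :=
  S.inf fun v => (I.followerWeight v : WithTop K)

/-- `F` is a suitable reaction of the follower to `L`: it consists of follower vertices, and
`L ∪ F` is a nonempty independent set. -/
def IsSuitableReaction (I : BISInstance K n) (L F : Finset (Fin n)) : Prop :=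
  F ⊆ I.leaderᶜ ∧ I.graph.IsIndepSet (↑(L ∪ F) : Set (Fin n)) ∧ (L ∪ F).Nonempty

/-- `F` is a suitable reaction to `L` that is best possible for the follower. -/
def IsPossibleReaction (I : BISInstance K n) (L F : Finset (Fin n)) : Prop :=
  I.IsSuitableReaction L F ∧
    ∀ F', I.IsSuitableReaction L F' → I.followerObjective (L ∪ F') ≤ I.followerObjective (L ∪ F)

/-- `F` is an optimal reaction of the pessimistic follower to `L`: among the reactions that are
best for the follower, it is worst for the leader. -/
def IsPessimisticReaction (I : BISInstance K n) (L F : Finset (Fin n)) : Prop :=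
  I.IsPossibleReaction L F ∧
    ∀ F', I.IsPossibleReaction L F' → I.leaderObjective (L ∪ F) ≤ I.leaderObjective (L ∪ F')

/-- `L ⊆ V_ℓ` is an optimal action of the leader and `F` is an optimal pessimistic reaction. -/
def IsOptimalSolution (I : BISInstance K n) (L F : Finset (Fin n)) : Prop :=
  L ⊆ I.leader ∧ I.IsPessimisticReaction L F ∧
    ∀ L' F', L' ⊆ I.leader → I.IsPessimisticReaction L' F' →
      I.leaderObjective (L' ∪ F') ≤ I.leaderObjective (L ∪ F)

/-- `L` is an optimal action of the leader. -/
def IsOptimalAction (I : BISInstance K n) (L : Finset (Fin n)) : Prop :=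
  ∃ F, I.IsOptimalSolution L F

/-- `M` is an independent subset of `V_ℓ` of maximum leader weight among all of these. -/
def IsMaxWeightLeaderIndepSet (I : BISInstance K n) (M : Finset (Fin n)) : Prop :=
  M ⊆ I.leader ∧ I.graph.IsIndepSet (↑M : Set (Fin n)) ∧
    ∀ M' ⊆ I.leader, I.graph.IsIndepSet (↑M' : Set (Fin n)) →
      I.leaderObjective M' ≤ I.leaderObjective M

end BISInstance

/-! ### An additive random access machine

Programs of a small imperative language.  The memory has two sorts of cells: naturals (used for
counting and addressing) and numbers of an ordered field `K` (the weights).  Each sort is organised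
in arrays: a program names finitely many arrays and addresses their cells by computed indices; a
scalar variable is an array used only at index `0`.  Numbers can only be copied, added, subtracted
and compared, and naturals only added, subtracted (truncated) and compared. -/

namespace AddRAM

/-- A memory content: `nat a i` and `num a i` are the cells with index `i` in the array `a`. -/
structure State (K : Type) where
  nat : ℕ → ℕ → ℕ
  num : ℕ → ℕ → K

inductive NatExp where
  | lit (k : ℕ)
  | get (a : ℕ) (i : NatExp)
  | plus (e f : NatExp)
  | minus (e f : NatExp)

inductive NumExp where
  | zero
  | get (a : ℕ) (i : NatExp)
  | plus (e f : NumExp)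
  | minus (e f : NumExp)

inductive Test where
  | natLe (e f : NatExp)
  | numLe (e f : NumExp)
  | neg (b : Test)
  | conj (b c : Test)

inductive Program where
  | skip
  | setNat (a : ℕ) (i e : NatExp)
  | setNum (a : ℕ) (i : NatExp) (e : NumExp)
  | seq (P Q : Program)
  | branch (b : Test) (P Q : Program)
  | loop (b : Test) (P : Program)

/-- What is charged for producing a value in the course of a computation. -/
structure CostMeasure (K : Type) where
  nat : ℕ → ℕ
  num : K → ℕ

/-- Unit cost: every operation costs `1`. -/
def unitCost (K : Type) : CostMeasure K where
  nat _ := 1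
  num _ := 1

/-- The length of the binary notation of a rational number (numerator and denominator). -/
def ratLength (q : ℚ) : ℕ := Nat.size q.num.natAbs + Nat.size q.den

/-- Logarithmic (bit) cost: every operation costs one more than the binary length of its result.
The operands are charged where they are produced. -/
def bitCost : CostMeasure ℚ where
  nat k := Nat.size k + 1
  num q := ratLength q + 1

section semantics

variable {K : Type} [Field K] [LinearOrder K]

def NatExp.eval (σ : State K) : NatExp → ℕ
  | .lit k => k
  | .get a i => σ.nat a (i.eval σ)
  | .plus e f => e.eval σ + f.eval σ
  | .minus e f => e.eval σ - f.eval σ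

def NatExp.cost (C : CostMeasure K) (σ : State K) : NatExp → ℕ
  | .lit k => C.nat k
  | .get a i => i.cost C σ + C.nat (σ.nat a (i.eval σ))
  | .plus e f => e.cost C σ + f.cost C σ + C.nat (e.eval σ + f.eval σ)
  | .minus e f => e.cost C σ + f.cost C σ + C.nat (e.eval σ - f.eval σ)

def NumExp.eval (σ : State K) : NumExp → K
  | .zero => 0
  | .get a i => σ.num a (i.eval σ)
  | .plus e f => e.eval σ + f.eval σ
  | .minus e f => e.eval σ - f.eval σ

def NumExp.cost (C : CostMeasure K) (σ : State K) : NumExp → ℕ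
  | .zero => C.num 0
  | .get a i => i.cost C σ + C.num (σ.num a (i.eval σ))
  | .plus e f => e.cost C σ + f.cost C σ + C.num (e.eval σ + f.eval σ)
  | .minus e f => e.cost C σ + f.cost C σ + C.num (e.eval σ - f.eval σ)

/-- The truth of a test in a state. -/
def Test.Holds (σ : State K) : Test → Prop
  | .natLe e f => e.eval σ ≤ f.eval σ
  | .numLe e f => e.eval σ ≤ f.eval σ
  | .neg b => ¬ b.Holds σ
  | .conj b c => b.Holds σ ∧ c.Holds σ

def Test.cost (C : CostMeasure K) (σ : State K) : Test → ℕ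
  | .natLe e f => e.cost C σ + f.cost C σ + 1
  | .numLe e f => e.cost C σ + f.cost C σ + 1
  | .neg b => b.cost C σ + 1
  | .conj b c => b.cost C σ + c.cost C σ + 1

/-- Overwrite the natural cell `i` of array `a`. -/
def State.writeNat (σ : State K) (a i x : ℕ) : State K where
  nat := fun b j => if b = a ∧ j = i then x else σ.nat b j
  num := σ.num

/-- Overwrite the number cell `i` of array `a`. -/
def State.writeNum (σ : State K) (a i : ℕ) (x : K) : State K where
  nat := σ.nat
  num := fun b j => if b = a ∧ j = i then x else σ.num b j

/-- `Exec C P σ τ t`: the program `P`, started in the state `σ`, halts in the state `τ`, and its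
run costs `t` with respect to `C`. -/
inductive Exec (C : CostMeasure K) : Program → State K → State K → ℕ → Prop
  | skip (σ : State K) : Exec C .skip σ σ 1
  | setNat (a : ℕ) (i e : NatExp) (σ : State K) :
      Exec C (.setNat a i e) σ (σ.writeNat a (i.eval σ) (e.eval σ))
        (i.cost C σ + e.cost C σ + 1)
  | setNum (a : ℕ) (i : NatExp) (e : NumExp) (σ : State K) :
      Exec C (.setNum a i e) σ (σ.writeNum a (i.eval σ) (e.eval σ))
        (i.cost C σ + e.cost C σ + 1)
  | seq {P Q : Program} {σ₁ σ₂ σ₃ : State K} {t₁ t₂ : ℕ} :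
      Exec C P σ₁ σ₂ t₁ → Exec C Q σ₂ σ₃ t₂ → Exec C (.seq P Q) σ₁ σ₃ (t₁ + t₂)
  | branch_true {b : Test} {P Q : Program} {σ τ : State K} {t : ℕ} :
      b.Holds σ → Exec C P σ τ t → Exec C (.branch b P Q) σ τ (b.cost C σ + t)
  | branch_false {b : Test} {P Q : Program} {σ τ : State K} {t : ℕ} :
      ¬ b.Holds σ → Exec C Q σ τ t → Exec C (.branch b P Q) σ τ (b.cost C σ + t)
  | loop_true {b : Test} {P : Program} {σ₁ σ₂ σ₃ : State K} {t₁ t₂ : ℕ} :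
      b.Holds σ₁ → Exec C P σ₁ σ₂ t₁ → Exec C (.loop b P) σ₂ σ₃ t₂ →
        Exec C (.loop b P) σ₁ σ₃ (b.cost C σ₁ + t₁ + t₂)
  | loop_false {b : Test} {P : Program} {σ : State K} :
      ¬ b.Holds σ → Exec C (.loop b P) σ σ (b.cost C σ)

end semantics

end AddRAM

/-! ### Input and output of the machine -/

namespace BISInstance

variable {K : Type} [Field K] [LinearOrder K] [IsStrictOrderedRing K] {n : ℕ}

open Classical in
/-- The initial memory.  Natural array `0` holds `n` at index `0`; natural array `1` holds the
adjacency matrix of the graph, row by row; natural array `2` marks the vertices of the leader;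
number arrays `0` and `1` hold the weights of the leader and the follower.  All other cells
are `0`.  In particular no bipartition of the graph is supplied. -/
noncomputable def encode (I : BISInstance K n) : AddRAM.State K where
  nat a i :=
    if a = 0 then (if i = 0 then n else 0)
    else if a = 1 then
      (if ∃ u v : Fin n, i = (u : ℕ) * n + (v : ℕ) ∧ I.graph.Adj u v then 1 else 0)
    else if a = 2 then (if ∃ v ∈ I.leader, i = (v : ℕ) then 1 else 0)
    else 0
  num a i :=
    if h : i < n then
      (if a = 0 then I.leaderWeight ⟨i, h⟩ else if a = 1 then I.followerWeight ⟨i, h⟩ else 0)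
    else 0

/-- The final memory `τ` holds a solution of the instance: for an optimal action `L` of the leader
and an optimal pessimistic reaction `F` to it, natural array `3` is the indicator of `L ∪ F` (whose
intersection with `V_ℓ` is `L`), and number array `2` holds the optimal value at index `0`. -/
def IsSolvedBy (I : BISInstance K n) (τ : AddRAM.State K) : Prop :=
  ∃ L F : Finset (Fin n), I.IsOptimalSolution L F ∧
    (∀ v : Fin n, τ.nat 3 v = if v ∈ L ∪ F then 1 else 0) ∧
    τ.num 2 0 = I.leaderObjective (L ∪ F)

/-- The program `P`, run on the instance, halts at cost at most `T` with a solution in memory. -/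
def SolvedWithin (I : BISInstance K n) (P : AddRAM.Program) (C : AddRAM.CostMeasure K)
    (T : ℕ) : Prop :=
  ∃ (τ : AddRAM.State K) (t : ℕ), AddRAM.Exec C P I.encode τ t ∧ t ≤ T ∧ I.IsSolvedBy τ

/-- The size of an instance with rational weights: the number of vertices plus the total binary
length of all weights. -/
def bitLength (I : BISInstance ℚ n) : ℕ :=
  n + ∑ v, (AddRAM.ratLength (I.leaderWeight v) + AddRAM.ratLength (I.followerWeight v))

end BISInstance

/-! Against a nonempty independent action `L`, further vertices can only lower the follower's
minimum and, as weights are nonnegative, only raise the leader's sum. So `∅` is an optimal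
pessimistic reaction and the action is worth the weight of `L`. Against `∅` the follower must play
something, and a single vertex `b` of largest follower weight, with least leader weight among those,
is optimal. The optimum is therefore the larger of the leader weight of `b` and the weight of a
maximum weight independent set of the leader, with care for the case that this set is empty
(`isPessimisticReaction_empty`, `IsBestFollowerVertex.isPessimisticReaction`). This gives the
structural statement and leaves a maximum weight independent set problem in a bipartite graph.

That problem is solved by a flow: one colour class supplies its weights, the other demands its
weights, and arcs have unlimited capacity. A push-relabel method with labels up to `n + 1` stops
when all positive excess sits at label `n + 1`, while deficits keep label `0`. The `n` vertices
cannot use all of the labels `0, …, n`. If `k` is unused, the suppliers above `k` and the demanders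
below `k` form an independent set (`cutSide_independent`), which is heaviest by complementary
slackness with the preflow (`IsPreflow.sum_le_cutSide`). A natural-number potential bounds the
number of pushes and relabelings independently of the weights.

The machine cannot multiply. Hence a common denominator of the weights persists and each operation
lengthens numerators by at most one bit, so polynomially many operations have polynomial bit cost
(`Exec.bitCost`). The program consists of guarded commands enabled by a pair of indices;
`whileFind_reaches` and its variants verify them by an invariant and a potential. -/

namespace AddRAM

/-! ### Time-bounded reasoning about programs -/

section logic

variable {K : Type}

/-! ### Working space

The natural array `6` serves as working space of searches. -/

/-- The state with the working space of the search cleared. -/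
def State.core (σ : State K) : State K where
  nat a i := if a = 6 then 0 else σ.nat a i
  num := σ.num

/-- The search is at the pair `(u, v)`. -/
structure State.At (σ : State K) (n u v : ℕ) : Prop where
  row : σ.nat 6 0 = u
  col : σ.nat 6 1 = v
  -- There is no multiplication, so the row offset is carried along and grows by `n` with each row.
  start : σ.nat 6 2 = u * n

theorem State.core_writeNat_search (σ : State K) (i x : ℕ) : (σ.writeNat 6 i x).core = σ.core := by
  simp only [State.core, State.writeNat, State.mk.injEq, and_true]
  funext a j
  split_ifs <;> simp_all

theorem State.core_writeNat (σ : State K) {a : ℕ} (ha : a ≠ 6) (i x : ℕ) :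
    (σ.writeNat a i x).core = σ.core.writeNat a i x := by
  simp only [State.core, State.writeNat, State.mk.injEq, and_true]
  funext b j
  split_ifs <;> simp_all

theorem State.core_writeNum (σ : State K) (a i : ℕ) (x : K) :
    (σ.writeNum a i x).core = σ.core.writeNum a i x := rfl

/-! ### Unit cost and runs of programs -/

/-- The unit cost of an expression, which does not depend on the state. -/
def NatExp.ops : NatExp → ℕ
  | .lit _ => 1
  | .get _ i => i.ops + 1
  | .plus e f => e.ops + f.ops + 1
  | .minus e f => e.ops + f.ops + 1

def NumExp.ops : NumExp → ℕ
  | .zero => 1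
  | .get _ i => i.ops + 1
  | .plus e f => e.ops + f.ops + 1
  | .minus e f => e.ops + f.ops + 1

def Test.ops : Test → ℕ
  | .natLe e f => e.ops + f.ops + 1
  | .numLe e f => e.ops + f.ops + 1
  | .neg b => b.ops + 1
  | .conj b c => b.ops + c.ops + 1

theorem NatExp.cost_unitCost (σ : State K) (e : NatExp) : e.cost (unitCost K) σ = e.ops := by
  induction e <;> simp_all [NatExp.cost, NatExp.ops, unitCost]

variable [Field K]

theorem NumExp.cost_unitCost (σ : State K) (e : NumExp) : e.cost (unitCost K) σ = e.ops := by
  induction e <;> simp_all [NumExp.cost, NumExp.ops, NatExp.cost_unitCost] <;> simp [unitCost]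

theorem Test.cost_unitCost (σ : State K) (b : Test) : b.cost (unitCost K) σ = b.ops := by
  induction b <;> simp_all [Test.cost, Test.ops, NatExp.cost_unitCost, NumExp.cost_unitCost]

variable [LinearOrder K]

/-- An upper bound for the unit cost of a program without loops. -/
def Program.ops : Program → ℕ
  | .skip => 1
  | .setNat _ i e => i.ops + e.ops + 1
  | .setNum _ i e => i.ops + e.ops + 1
  | .seq P Q => P.ops + Q.ops
  | .branch b P Q => b.ops + P.ops + Q.ops
  | .loop _ _ => 0

def Program.LoopFree : Program → Prop
  | .skip => True
  | .setNat _ _ _ => True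
  | .setNum _ _ _ => True
  | .seq P Q => P.LoopFree ∧ Q.LoopFree
  | .branch _ P Q => P.LoopFree ∧ Q.LoopFree
  | .loop _ _ => False

open Classical in
/-- The effect of a program without loops. -/
noncomputable def Program.run : Program → State K → State K
  | .skip, σ => σ
  | .setNat a i e, σ => σ.writeNat a (i.eval σ) (e.eval σ)
  | .setNum a i e, σ => σ.writeNum a (i.eval σ) (e.eval σ)
  | .seq P Q, σ => Q.run (P.run σ)
  | .branch b P Q, σ => if b.Holds σ then P.run σ else Q.run σ
  | .loop _ _, σ => σ

/-- The program `P`, started in `σ`, halts at unit cost at most `T` in a state satisfying `Q`. -/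
def Reaches (P : Program) (σ : State K) (T : ℕ) (Q : State K → Prop) : Prop :=
  ∃ τ t, Exec (unitCost K) P σ τ t ∧ t ≤ T ∧ Q τ

theorem Reaches.mono {P : Program} {σ : State K} {T T' : ℕ} {Q Q' : State K → Prop}
    (h : Reaches P σ T Q) (hT : T ≤ T') (hQ : ∀ τ, Q τ → Q' τ) : Reaches P σ T' Q' := by
  obtain ⟨τ, t, h1, h2, h3⟩ := h
  exact ⟨τ, t, h1, h2.trans hT, hQ _ h3⟩

theorem Reaches.seq {P P' : Program} {σ : State K} {T T' : ℕ} {Q Q' : State K → Prop}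
    (h : Reaches P σ T Q) (h' : ∀ τ, Q τ → Reaches P' τ T' Q') :
    Reaches (.seq P P') σ (T + T') Q' := by
  obtain ⟨τ, t, h1, h2, h3⟩ := h
  obtain ⟨τ', t', h1', h2', h3'⟩ := h' τ h3
  exact ⟨τ', t + t', h1.seq h1', by omega, h3'⟩

/-- Charging both branches keeps the time bound independent of the state. -/
theorem Reaches.branch {b : Test} {P P' : Program} {σ : State K} {T T' : ℕ} {Q : State K → Prop}
    (h : b.Holds σ → Reaches P σ T Q) (h' : ¬ b.Holds σ → Reaches P' σ T' Q) :
    Reaches (.branch b P P') σ (b.ops + T + T') Q := by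
  by_cases hb : b.Holds σ
  · obtain ⟨τ, t, h1, h2, h3⟩ := h hb
    refine ⟨τ, _, h1.branch_true hb, ?_, h3⟩
    rw [Test.cost_unitCost]; omega
  · obtain ⟨τ, t, h1, h2, h3⟩ := h' hb
    refine ⟨τ, _, h1.branch_false hb, ?_, h3⟩
    rw [Test.cost_unitCost]; omega

/-- Reduces loop-free code to computing the function `Program.run`, which `simp` can unfold. -/
theorem Reaches.of_run {P : Program} (hP : P.LoopFree) {σ : State K} {Q : State K → Prop}
    (h : Q (P.run σ)) : Reaches P σ P.ops Q := by
  refine Reaches.mono (Q := fun τ => τ = P.run σ) ?_ le_rfl (by rintro _ rfl; exact h)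
  clear h
  induction P generalizing σ with
  | skip => exact ⟨_, _, .skip σ, le_rfl, rfl⟩
  | setNat a i e =>
    exact ⟨_, _, .setNat a i e σ, by simp [NatExp.cost_unitCost, Program.ops], rfl⟩
  | setNum a i e =>
    exact ⟨_, _, .setNum a i e σ, by
      simp [NatExp.cost_unitCost, NumExp.cost_unitCost, Program.ops], rfl⟩
  | seq P P' ih ih' =>
    exact (ih hP.1).seq (by rintro _ rfl; exact ih' hP.2)
  | branch b P P' ih ih' =>
    refine Reaches.branch (fun hb => ?_) (fun hb => ?_)
    · simpa [Program.run, hb] using ih hP.1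
    · simpa [Program.run, hb] using ih' hP.2
  | loop b P ih => exact hP.elim

/-! ### Search for a pair of indices -/

abbrev rowIndex : NatExp := .get 6 (.lit 0)
abbrev colIndex : NatExp := .get 6 (.lit 1)
abbrev rowStart : NatExp := .get 6 (.lit 2)
abbrev foundFlag : NatExp := .get 6 (.lit 3)
abbrev dimension : NatExp := .get 0 (.lit 0)

abbrev Test.natLt (e f : NatExp) : Test := .neg (.natLe f e)
abbrev Test.numLt (e f : NumExp) : Test := .neg (.numLe f e)
abbrev Test.natEq (e f : NatExp) : Test := .conj (.natLe e f) (.natLe f e)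

/-- Move the search on to the next pair. -/
def nextPair : Program :=
  .seq (.setNat 6 (.lit 1) (.plus colIndex (.lit 1)))
    (.branch (.natLe dimension colIndex)
      (.seq (.setNat 6 (.lit 1) (.lit 0))
        (.seq (.setNat 6 (.lit 0) (.plus rowIndex (.lit 1)))
          (.setNat 6 (.lit 2) (.plus rowStart dimension))))
      .skip)

def searchLoop (T : Test) : Program :=
  .loop (.conj (.natLe foundFlag (.lit 0)) (.natLt rowIndex dimension))
    (.branch T (.setNat 6 (.lit 3) (.lit 1)) nextPair)

/-- Search for a pair that passes the test `T`. -/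
def findPair (T : Test) : Program :=
  .seq (.seq (.seq (.setNat 6 (.lit 0) (.lit 0)) (.setNat 6 (.lit 1) (.lit 0)))
    (.seq (.setNat 6 (.lit 2) (.lit 0)) (.setNat 6 (.lit 3) (.lit 0)))) (searchLoop T)

/-- The test `T` expresses the relation `R`. -/
def Test.Expresses (T : Test) (n : ℕ) (R : State K → ℕ → ℕ → Prop) : Prop :=
  ∀ (σ : State K) (u v : ℕ), u < n → v < n → σ.At n u v → (T.Holds σ ↔ R σ.core u v)

def searchTime (T : Test) (n : ℕ) : ℕ := (n * n + 1) * (T.ops + 60) + 60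

/-- The outcome of a search started in a state with core `σ`. -/
def SearchResult (n : ℕ) (R : State K → ℕ → ℕ → Prop) (σ τ : State K) : Prop :=
  τ.core = σ ∧ ((τ.nat 6 3 = 1 ∧ ∃ u v, u < n ∧ v < n ∧ τ.At n u v ∧ R σ u v) ∨
    (τ.nat 6 3 = 0 ∧ ∀ u v, u < n → v < n → ¬ R σ u v))

theorem Reaches.loop_true {b : Test} {P : Program} {σ : State K} {T T' : ℕ} {Q Q' : State K → Prop}
    (hb : b.Holds σ) (h : Reaches P σ T Q) (h' : ∀ τ, Q τ → Reaches (.loop b P) τ T' Q') :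
    Reaches (.loop b P) σ (b.ops + T + T') Q' := by
  obtain ⟨τ, t, h1, h2, h3⟩ := h
  obtain ⟨τ', t', h1', h2', h3'⟩ := h' τ h3
  refine ⟨τ', _, h1.loop_true hb h1', ?_, h3'⟩
  rw [Test.cost_unitCost]; omega

theorem Reaches.loop_false {b : Test} {P : Program} {σ : State K} {Q : State K → Prop}
    (hb : ¬ b.Holds σ) (h : Q σ) : Reaches (.loop b P) σ b.ops Q :=
  ⟨σ, _, .loop_false hb, by rw [Test.cost_unitCost], h⟩

theorem searchLoop_guard_holds (σ : State K) :
    (Test.conj (.natLe foundFlag (.lit 0)) (.natLt rowIndex dimension)).Holds σ ↔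
      σ.nat 6 3 = 0 ∧ σ.nat 6 0 < σ.nat 0 0 := by
  simp [Test.Holds, NatExp.eval]

theorem nextPair_reaches {n u v : ℕ} (hv : v < n) {σ : State K}
    (hn : σ.nat 0 0 = n) (hat : σ.At n u v) :
    Reaches nextPair σ 40 fun τ => τ.core = σ.core ∧ τ.nat 6 3 = σ.nat 6 3 ∧
      ∃ u' v', v' < n ∧ u' * n + v' = u * n + v + 1 ∧ τ.At n u' v' := by
  obtain ⟨h0, h1, h2⟩ := hat
  refine Reaches.mono (Reaches.of_run (P := nextPair) (by simp [nextPair, Program.LoopFree]) ?_)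
    (by simp [nextPair, Program.ops, NatExp.ops, Test.ops]) (fun _ h => h)
  by_cases hv' : n ≤ v + 1
  · have hrun : nextPair.run σ = (((σ.writeNat 6 1 (v + 1)).writeNat 6 1 0).writeNat 6 0
        (u + 1)).writeNat 6 2 (u * n + n) := by
      simp [nextPair, Program.run, NatExp.eval, Test.Holds, State.writeNat, h0, h1, h2, hn, hv']
    rw [hrun]
    refine ⟨by simp only [State.core_writeNat_search], by simp [State.writeNat],
      u + 1, 0, by omega, by rw [Nat.succ_mul]; omega, ?_, ?_, ?_⟩ <;>
    simp [State.writeNat, Nat.succ_mul]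
  · have hrun : nextPair.run σ = σ.writeNat 6 1 (v + 1) := by
      simp [nextPair, Program.run, NatExp.eval, Test.Holds, State.writeNat, h1, hn, hv']
    rw [hrun]
    refine ⟨by simp only [State.core_writeNat_search], by simp [State.writeNat],
      u, v + 1, by omega, by omega, ?_, ?_, ?_⟩ <;> simp [State.writeNat, h0, h2]

/-- Induction on the number `m` of pairs not yet visited, where pairs are ordered by their index `u
* n + v`. -/
theorem searchLoop_reaches {n : ℕ} {T : Test} {R : State K → ℕ → ℕ → Prop}
    (hT : T.Expresses n R) (m : ℕ) :
    ∀ (σ : State K) (u v : ℕ), σ.nat 0 0 = n → u * n + v + m = n * n → v < n → σ.At n u v →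
      σ.nat 6 3 = 0 → (∀ u' v', v' < n → u' * n + v' < u * n + v → ¬ R σ.core u' v') →
      Reaches (searchLoop T) σ ((m + 1) * (T.ops + 60) + 20) (SearchResult n R σ.core) := by
  induction m with
  | zero =>
    intro σ u v hn hm hv hat hf hno
    have hu : n ≤ u := by
      by_contra h
      have : (u + 1) * n ≤ n * n := Nat.mul_le_mul_right _ (by omega)
      rw [Nat.succ_mul] at this
      omega
    refine Reaches.mono (Reaches.loop_false (Q := SearchResult n R σ.core) ?_ ?_) ?_ (fun _ h => h)
    · rw [searchLoop_guard_holds, hat.row, hn]; omega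
    · refine ⟨rfl, Or.inr ⟨hf, fun u' v' hu' hv' => hno u' v' hv' ?_⟩⟩
      have : (u' + 1) * n ≤ n * n := Nat.mul_le_mul_right _ hu'
      rw [Nat.succ_mul] at this
      omega
    · simp [Test.ops, NatExp.ops]
  | succ m ih =>
    intro σ u v hn hm hv hat hf hno
    have hu : u < n := by
      by_contra h
      have : n * n ≤ u * n := Nat.mul_le_mul_right _ (by omega)
      omega
    have hguard : (Test.conj (.natLe foundFlag (.lit 0)) (.natLt rowIndex dimension)).Holds σ := by
      rw [searchLoop_guard_holds, hat.row, hn]; exact ⟨hf, hu⟩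
    refine Reaches.mono (Reaches.loop_true (T := T.ops + 4 + 40)
      (T' := (m + 1) * (T.ops + 60) + 20)
      (Q := fun τ => τ.core = σ.core ∧ ((τ.nat 6 3 = 1 ∧ τ.At n u v ∧ R σ.core u v) ∨
        (τ.nat 6 3 = 0 ∧ ¬ R σ.core u v ∧
          ∃ u' v', v' < n ∧ u' * n + v' = u * n + v + 1 ∧ τ.At n u' v')))
      (Q' := SearchResult n R σ.core) hguard ?_ ?_) ?_ (fun _ h => h)
    · refine Reaches.branch (fun hb => ?_) (fun hb => ?_)
      · refine Reaches.mono (Reaches.of_run (P := .setNat 6 (.lit 3) (.lit 1)) trivial ?_)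
          (by simp [Program.ops, NatExp.ops]) (fun _ h => h)
        refine ⟨by simp only [Program.run, NatExp.eval, State.core_writeNat_search],
          Or.inl ⟨by simp [Program.run, State.writeNat, NatExp.eval], ⟨?_, ?_, ?_⟩,
            (hT σ u v hu hv hat).1 hb⟩⟩ <;>
        simp [Program.run, State.writeNat, NatExp.eval, hat.row, hat.col, hat.start]
      · refine Reaches.mono (nextPair_reaches hv hn hat) le_rfl ?_
        rintro τ ⟨h1, h2, h3⟩
        exact ⟨h1, Or.inr ⟨h2.trans hf, fun h => hb ((hT σ u v hu hv hat).2 h), h3⟩⟩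
    · rintro τ ⟨hc, ⟨hf', hat', hR⟩ | ⟨hf', hR, u', v', hv', huv, hat'⟩⟩
      · refine Reaches.mono (Reaches.loop_false (Q := SearchResult n R σ.core) ?_
          ⟨hc, Or.inl ⟨hf', u, v, hu, hv, hat', hR⟩⟩) ?_ (fun _ h => h)
        · rw [searchLoop_guard_holds]; omega
        · simp [Test.ops, NatExp.ops]
      · have hn' : τ.nat 0 0 = n := by
          rw [← hn]
          simpa [State.core] using congrArg (fun ρ : State K => ρ.nat 0 0) hc
        have key := ih τ u' v' hn' (by omega) hv' hat' hf' ?_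
        · rwa [hc] at key
        · intro u'' v'' hv'' hlt
          rw [hc]
          rcases Nat.lt_or_ge (u'' * n + v'') (u * n + v) with h | h
          · exact hno u'' v'' hv'' h
          -- The only pair newly excluded is the current one, since an index determines its pair
          -- when columns are below `n`.
          · have heq : u'' * n + v'' = u * n + v := by omega
            have e1 : v'' = v := by
              have := congrArg (· % n) heq
              simpa [Nat.mul_add_mod_of_lt, Nat.mod_eq_of_lt hv, Nat.mod_eq_of_lt hv''] using this
            have e2 : u'' = u := by
              subst e1
              exact Nat.eq_of_mul_eq_mul_right (by omega) (Nat.add_right_cancel heq)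
            rwa [e1, e2]
    · simp only [Test.ops, NatExp.ops]
      rw [Nat.succ_mul (m + 1)]; omega

theorem findPair_reaches {n : ℕ} (hpos : 0 < n) {T : Test} {R : State K → ℕ → ℕ → Prop}
    (hT : T.Expresses n R) (σ : State K) (hn : σ.nat 0 0 = n) :
    Reaches (findPair T) σ (searchTime T n) (SearchResult n R σ.core) := by
  refine Reaches.mono (Reaches.seq (T := 12) (T' := (n * n + 1) * (T.ops + 60) + 20)
    (Q := fun τ => τ.core = σ.core ∧ τ.At n 0 0 ∧ τ.nat 6 3 = 0) (Reaches.of_run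
      (by simp [Program.LoopFree]) ?_) ?_) ?_ (fun _ h => h)
  · refine ⟨by simp only [Program.run, NatExp.eval, State.core_writeNat_search], ⟨?_, ?_, ?_⟩, ?_⟩ <;>
    simp [Program.run, NatExp.eval, State.writeNat]
  · rintro τ ⟨hc, hat, hf⟩
    rw [← hc]
    refine searchLoop_reaches hT (n * n) τ 0 0 ?_ (by simp) hpos hat hf (by simp)
    rw [← hn]
    simpa [State.core] using congrArg (fun ρ : State K => ρ.nat 0 0) hc
  · simp only [searchTime]; omega

/-! ### Guarded commands -/

/-- If some pair passes the test `T`, then run `A` at such a pair, and otherwise run `P`. -/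
def firstOf (T : Test) (A P : Program) : Program :=
  .seq (findPair T) (.branch (.natLe (.lit 1) foundFlag)
    -- `A` may contain searches of its own, which overwrite the flag; it is set again to report
    -- success.
    (.seq A (.setNat 6 (.lit 3) (.lit 1))) P)

theorem firstOf_reaches {n : ℕ} (hpos : 0 < n) {T : Test} {R : State K → ℕ → ℕ → Prop}
    (hT : T.Expresses n R) {A P : Program} {tA tP : ℕ} {Q : State K → Prop}
    {σ : State K} (hn : σ.nat 0 0 = n)
    (hA : ∀ τ u v, τ.core = σ.core → u < n → v < n → τ.At n u v → R σ.core u v →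
      Reaches A τ tA fun ρ => Q (ρ.writeNat 6 3 1))
    (hP : ∀ τ, τ.core = σ.core → τ.nat 6 3 = 0 → (∀ u v, u < n → v < n → ¬ R σ.core u v) →
      Reaches P τ tP Q) :
    Reaches (firstOf T A P) σ (searchTime T n + tA + tP + 10) Q := by
  refine Reaches.mono (Reaches.seq (T' := 4 + (tA + 3) + tP) (findPair_reaches hpos hT σ hn) ?_)
    (by omega) (fun _ h => h)
  rintro τ ⟨hc, h⟩
  refine Reaches.branch (fun hb => ?_) (fun hb => ?_)
  · have hb' : 1 ≤ τ.nat 6 3 := by simpa [Test.Holds, NatExp.eval] using hb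
    rcases h with ⟨hf, u, v, hu, hv, hat, hR⟩ | ⟨hf, -⟩
    · refine Reaches.seq (hA τ u v hc hu hv hat hR) ?_
      intro ρ hρ
      exact Reaches.mono (Reaches.of_run (P := .setNat 6 (.lit 3) (.lit 1)) trivial hρ)
        (by simp [Program.ops, NatExp.ops]) (fun _ h => h)
    · omega
  · have hb' : ¬ 1 ≤ τ.nat 6 3 := by simpa [Test.Holds, NatExp.eval] using hb
    rcases h with ⟨hf, -⟩ | ⟨hf, hR⟩
    · omega
    · exact hP τ hc hf hR

/-- The action `A`, run at a pair, has the effect `F` outside the working space. -/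
def Program.Performs (A : Program) (n : ℕ) (F : State K → ℕ → ℕ → State K) : Prop :=
  A.LoopFree ∧ ∀ (σ : State K) (u v : ℕ), u < n → v < n → σ.At n u v →
    (A.run σ).core = F σ.core u v

def repeatWhileFound (P : Program) : Program :=
  .seq (.setNat 6 (.lit 3) (.lit 1)) (.loop (.natLe (.lit 1) foundFlag) P)

/-- Every successful round lowers `Φ`, so there are at most `Φ σ.core + 1` rounds, the last of which
finds nothing and leaves the core unchanged. Each round pays `4` for the guard. -/
theorem repeatWhileFound_reaches {P : Program} {c : ℕ} {Inv Fin : State K → Prop}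
    {Φ : State K → ℕ}
    (hP : ∀ σ : State K, Inv σ.core → Reaches P σ c fun τ =>
      (τ.nat 6 3 = 1 ∧ Inv τ.core ∧ Φ τ.core < Φ σ.core) ∨
      (τ.nat 6 3 = 0 ∧ τ.core = σ.core ∧ Fin σ.core))
    (σ : State K) (hσ : Inv σ.core) :
    Reaches (repeatWhileFound P) σ ((Φ σ.core + 1) * (c + 4) + 7)
      fun τ => Inv τ.core ∧ Fin τ.core := by
  have hloop : ∀ (m : ℕ) (σ : State K), Φ σ.core ≤ m → Inv σ.core → σ.nat 6 3 = 1 →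
      Reaches (.loop (.natLe (.lit 1) foundFlag) P) σ ((m + 1) * (c + 4) + 4)
        fun τ => Inv τ.core ∧ Fin τ.core := by
    intro m
    induction m with
    | zero =>
      intro σ hm hI hf
      refine Reaches.mono (Reaches.loop_true (T' := 4) (by simp [Test.Holds, NatExp.eval, hf])
        (hP σ hI) ?_) ?_ (fun _ h => h)
      · rintro τ (⟨-, -, h⟩ | ⟨hf', hc, hF⟩)
        · omega
        · rw [← hc] at hI hF
          exact Reaches.loop_false (by simp [Test.Holds, NatExp.eval, hf']) ⟨hI, hF⟩
      · simp [Test.ops, NatExp.ops]; omega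
    | succ m ih =>
      intro σ hm hI hf
      refine Reaches.mono (Reaches.loop_true (T' := (m + 1) * (c + 4) + 4)
        (by simp [Test.Holds, NatExp.eval, hf]) (hP σ hI) ?_) ?_ (fun _ h => h)
      · rintro τ (⟨hf', hI', h⟩ | ⟨hf', hc, hF⟩)
        · exact ih τ (by omega) hI' hf'
        · rw [← hc] at hI hF
          exact Reaches.mono (Reaches.loop_false (by simp [Test.Holds, NatExp.eval, hf']) ⟨hI, hF⟩)
            (by simp [Test.ops, NatExp.ops]) (fun _ h => h)
      · rw [Nat.succ_mul (m + 1)]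
        simp [Test.ops, NatExp.ops]; omega
  refine Reaches.mono (Reaches.seq (T := 3) (T' := (Φ σ.core + 1) * (c + 4) + 4)
    (Q := fun τ => τ.core = σ.core ∧ τ.nat 6 3 = 1)
    (Reaches.of_run (P := .setNat 6 (.lit 3) (.lit 1)) trivial ⟨?_, ?_⟩) ?_) (by omega)
    (fun _ h => h)
  · simp only [Program.run, NatExp.eval, State.core_writeNat_search]
  · simp [Program.run, NatExp.eval, State.writeNat]
  · rintro τ ⟨hc, hf⟩
    exact hloop _ τ (by rw [hc]) (by rwa [hc]) hf

/-- As long as some pair passes the test `T`, run `A` at such a pair. -/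
def whileFind (T : Test) (A : Program) : Program := repeatWhileFound (firstOf T A .skip)

def whileTime (T : Test) (A : Program) (n m : ℕ) : ℕ :=
  (m + 1) * (searchTime T n + A.ops + 15) + 7

theorem whileFind_reaches {n : ℕ} (hpos : 0 < n) {T : Test} {A : Program}
    {R : State K → ℕ → ℕ → Prop} {F : State K → ℕ → ℕ → State K}
    (hT : T.Expresses n R) (hA : A.Performs n F) {Inv : State K → Prop} {Φ : State K → ℕ}
    (hn : ∀ σ, Inv σ → σ.nat 0 0 = n)
    (hF : ∀ σ u v, u < n → v < n → Inv σ → R σ u v → Inv (F σ u v) ∧ Φ (F σ u v) < Φ σ)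
    (σ : State K) (hσ : Inv σ.core) {m : ℕ} (hm : Φ σ.core ≤ m) :
    Reaches (whileFind T A) σ (whileTime T A n m)
      fun τ => Inv τ.core ∧ ∀ u v, u < n → v < n → ¬ R τ.core u v := by
  refine Reaches.mono (repeatWhileFound_reaches (c := searchTime T n + A.ops + 1 + 10) (Φ := Φ)
    (Fin := fun σ => ∀ u v, u < n → v < n → ¬ R σ u v) ?_ σ hσ) ?_ (fun _ h => h)
  · intro σ hI
    refine firstOf_reaches hpos hT (by simpa [State.core] using hn _ hI) ?_ ?_
    · intro τ u v hc hu hv hat hR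
      refine Reaches.of_run hA.1 (Or.inl ⟨by simp [State.writeNat], ?_⟩)
      rw [State.core_writeNat_search, hA.2 τ u v hu hv hat, hc]
      exact hF _ u v hu hv hI hR
    · intro τ hc hf hR
      exact Reaches.of_run (P := .skip) trivial (Or.inr ⟨hf, hc, hR⟩)
  · simp only [whileTime]
    exact Nat.add_le_add_right (Nat.mul_le_mul (by omega) (by omega)) _

/-- Guarded commands with decreasing priority, repeated as long as one of them is enabled. -/
def whileFind₂ (T₁ : Test) (A₁ : Program) (T₂ : Test) (A₂ : Program) : Program :=
  repeatWhileFound (firstOf T₁ A₁ (firstOf T₂ A₂ .skip))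

def whileTime₂ (T₁ : Test) (A₁ : Program) (T₂ : Test) (A₂ : Program) (n m : ℕ) : ℕ :=
  (m + 1) * (searchTime T₁ n + A₁.ops + (searchTime T₂ n + A₂.ops) + 25) + 7

/-- A command of lower priority may assume that those above it are disabled. Fresh colours here, and
relabelings in the variant with three commands, are legitimate only for this reason. -/
theorem whileFind₂_reaches {n : ℕ} (hpos : 0 < n) {T₁ T₂ : Test} {A₁ A₂ : Program}
    {R₁ R₂ : State K → ℕ → ℕ → Prop} {F₁ F₂ : State K → ℕ → ℕ → State K}
    (hT₁ : T₁.Expresses n R₁) (hA₁ : A₁.Performs n F₁)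
    (hT₂ : T₂.Expresses n R₂) (hA₂ : A₂.Performs n F₂)
    {Inv : State K → Prop} {Φ : State K → ℕ}
    (hn : ∀ σ, Inv σ → σ.nat 0 0 = n)
    (hF₁ : ∀ σ u v, u < n → v < n → Inv σ → R₁ σ u v → Inv (F₁ σ u v) ∧ Φ (F₁ σ u v) < Φ σ)
    (hF₂ : ∀ σ u v, u < n → v < n → Inv σ → (∀ u v, u < n → v < n → ¬ R₁ σ u v) →
      R₂ σ u v → Inv (F₂ σ u v) ∧ Φ (F₂ σ u v) < Φ σ)
    (σ : State K) (hσ : Inv σ.core) {m : ℕ} (hm : Φ σ.core ≤ m) :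
    Reaches (whileFind₂ T₁ A₁ T₂ A₂) σ (whileTime₂ T₁ A₁ T₂ A₂ n m)
      fun τ => Inv τ.core ∧ (∀ u v, u < n → v < n → ¬ R₁ τ.core u v) ∧
        ∀ u v, u < n → v < n → ¬ R₂ τ.core u v := by
  refine Reaches.mono (repeatWhileFound_reaches
    (c := searchTime T₁ n + A₁.ops + (searchTime T₂ n + A₂.ops + 1 + 10) + 10) (Φ := Φ)
    (Fin := fun σ => (∀ u v, u < n → v < n → ¬ R₁ σ u v) ∧ ∀ u v, u < n → v < n → ¬ R₂ σ u v)
    ?_ σ hσ) ?_ (fun _ h => h)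
  · intro σ hI
    refine firstOf_reaches hpos hT₁ (by simpa [State.core] using hn _ hI) ?_ ?_
    · intro τ u v hc hu hv hat hR
      refine Reaches.of_run hA₁.1 (Or.inl ⟨by simp [State.writeNat], ?_⟩)
      rw [State.core_writeNat_search, hA₁.2 τ u v hu hv hat, hc]
      exact hF₁ _ u v hu hv hI hR
    · intro τ hc hf hR
      have hI' : Inv τ.core := by rwa [hc]
      refine firstOf_reaches hpos hT₂ (by simpa [State.core] using hn _ hI') ?_ ?_
      · intro ρ u v hc' hu hv hat hR'
        refine Reaches.of_run hA₂.1 (Or.inl ⟨by simp [State.writeNat], ?_⟩)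
        rw [hc] at hR' hc'
        rw [State.core_writeNat_search, hA₂.2 ρ u v hu hv hat, hc']
        exact hF₂ _ u v hu hv hI hR hR'
      · intro ρ hc' hf' hR'
        rw [hc] at hR' hc'
        exact Reaches.of_run (P := .skip) trivial (Or.inr ⟨hf', hc', hR, hR'⟩)
  · simp only [whileTime₂]
    exact Nat.add_le_add_right (Nat.mul_le_mul (by omega) (by omega)) _

/-- Guarded commands with decreasing priority, repeated as long as one of them is enabled. -/
def whileFind₃ (T₁ : Test) (A₁ : Program) (T₂ : Test) (A₂ : Program) (T₃ : Test) (A₃ : Program) :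
    Program :=
  repeatWhileFound (firstOf T₁ A₁ (firstOf T₂ A₂ (firstOf T₃ A₃ .skip)))

def whileTime₃ (T₁ : Test) (A₁ : Program) (T₂ : Test) (A₂ : Program) (T₃ : Test) (A₃ : Program)
    (n m : ℕ) : ℕ :=
  (m + 1) * (searchTime T₁ n + A₁.ops + (searchTime T₂ n + A₂.ops +
    (searchTime T₃ n + A₃.ops)) + 35) + 7

/-- At the end only the failure of the third test is recorded: the cut argument needs that no active
vertex can be relabeled, not that no push is possible. -/
theorem whileFind₃_reaches {n : ℕ} (hpos : 0 < n) {T₁ T₂ T₃ : Test} {A₁ A₂ A₃ : Program}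
    {R₁ R₂ R₃ : State K → ℕ → ℕ → Prop} {F₁ F₂ F₃ : State K → ℕ → ℕ → State K}
    (hT₁ : T₁.Expresses n R₁) (hA₁ : A₁.Performs n F₁)
    (hT₂ : T₂.Expresses n R₂) (hA₂ : A₂.Performs n F₂)
    (hT₃ : T₃.Expresses n R₃) (hA₃ : A₃.Performs n F₃)
    {Inv : State K → Prop} {Φ : State K → ℕ}
    (hn : ∀ σ, Inv σ → σ.nat 0 0 = n)
    (hF₁ : ∀ σ u v, u < n → v < n → Inv σ → R₁ σ u v → Inv (F₁ σ u v) ∧ Φ (F₁ σ u v) < Φ σ)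
    (hF₂ : ∀ σ u v, u < n → v < n → Inv σ → R₂ σ u v → Inv (F₂ σ u v) ∧ Φ (F₂ σ u v) < Φ σ)
    (hF₃ : ∀ σ u v, u < n → v < n → Inv σ → (∀ u v, u < n → v < n → ¬ R₁ σ u v) →
      (∀ u v, u < n → v < n → ¬ R₂ σ u v) →
      R₃ σ u v → Inv (F₃ σ u v) ∧ Φ (F₃ σ u v) < Φ σ)
    (σ : State K) (hσ : Inv σ.core) {m : ℕ} (hm : Φ σ.core ≤ m) :
    Reaches (whileFind₃ T₁ A₁ T₂ A₂ T₃ A₃) σ (whileTime₃ T₁ A₁ T₂ A₂ T₃ A₃ n m)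
      fun τ => Inv τ.core ∧ ∀ u v, u < n → v < n → ¬ R₃ τ.core u v := by
  refine Reaches.mono (repeatWhileFound_reaches
    (c := searchTime T₁ n + A₁.ops + (searchTime T₂ n + A₂.ops +
      (searchTime T₃ n + A₃.ops + 1 + 10) + 10) + 10) (Φ := Φ)
    (Fin := fun σ => ∀ u v, u < n → v < n → ¬ R₃ σ u v)
    ?_ σ hσ) ?_ (fun _ h => h)
  · intro σ hI
    refine firstOf_reaches hpos hT₁ (by simpa [State.core] using hn _ hI) ?_ ?_
    · intro τ u v hc hu hv hat hR
      refine Reaches.of_run hA₁.1 (Or.inl ⟨by simp [State.writeNat], ?_⟩)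
      rw [State.core_writeNat_search, hA₁.2 τ u v hu hv hat, hc]
      exact hF₁ _ u v hu hv hI hR
    · intro τ hc hf hR
      have hI' : Inv τ.core := by rwa [hc]
      refine firstOf_reaches hpos hT₂ (by simpa [State.core] using hn _ hI') ?_ ?_
      · intro ρ u v hc' hu hv hat hR'
        refine Reaches.of_run hA₂.1 (Or.inl ⟨by simp [State.writeNat], ?_⟩)
        rw [hc] at hR' hc'
        rw [State.core_writeNat_search, hA₂.2 ρ u v hu hv hat, hc']
        exact hF₂ _ u v hu hv hI hR'
      · intro ρ hc' hf' hR'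
        rw [hc] at hR' hc'
        have hI'' : Inv ρ.core := by rwa [hc']
        refine firstOf_reaches hpos hT₃ (by simpa [State.core] using hn _ hI'') ?_ ?_
        · intro κ u v hc'' hu hv hat hR''
          refine Reaches.of_run hA₃.1 (Or.inl ⟨by simp [State.writeNat], ?_⟩)
          rw [hc'] at hR'' hc''
          rw [State.core_writeNat_search, hA₃.2 κ u v hu hv hat, hc'']
          exact hF₃ _ u v hu hv hI hR hR' hR''
        · intro κ hc'' hf'' hR''
          rw [hc'] at hR'' hc''
          exact Reaches.of_run (P := .skip) trivial (Or.inr ⟨hf'', hc'', hR''⟩)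
  · simp only [whileTime₃]
    exact Nat.add_le_add_right (Nat.mul_le_mul (by omega) (by omega)) _

end logic

end AddRAM

/-! ### From unit cost to bit cost -/

namespace AddRAM

/-! ### Bit cost of a computation with few operations -/

def NatExp.maxLit : NatExp → ℕ
  | .lit k => k
  | .get _ i => i.maxLit
  | .plus e f => max e.maxLit f.maxLit
  | .minus e f => max e.maxLit f.maxLit

def NumExp.maxLit : NumExp → ℕ
  | .zero => 0
  | .get _ i => i.maxLit
  | .plus e f => max e.maxLit f.maxLit
  | .minus e f => max e.maxLit f.maxLit

def Test.maxLit : Test → ℕ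
  | .natLe e f => max e.maxLit f.maxLit
  | .numLe e f => max e.maxLit f.maxLit
  | .neg b => b.maxLit
  | .conj b c => max b.maxLit c.maxLit

def Program.maxLit : Program → ℕ
  | .skip => 0
  | .setNat _ i e => max i.maxLit e.maxLit
  | .setNum _ i e => max i.maxLit e.maxLit
  | .seq P Q => max P.maxLit Q.maxLit
  | .branch b P Q => max b.maxLit (max P.maxLit Q.maxLit)
  | .loop b P => max b.maxLit P.maxLit

/-- The number `x` is a fraction with denominator `D` and numerator below `2 ^ m`. -/
def IsSmallFraction (D m : ℕ) (x : ℚ) : Prop := ∃ z : ℤ, x * D = z ∧ |z| < 2 ^ m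

/-- All cells contain numbers of size `m`, with the common denominator `D`. -/
structure State.Small (D m : ℕ) (σ : State ℚ) : Prop where
  nat : ∀ a i, σ.nat a i < 2 ^ m
  num : ∀ a i, IsSmallFraction D m (σ.num a i)

theorem IsSmallFraction.mono {D m m' : ℕ} {x : ℚ} (h : IsSmallFraction D m x) (hm : m ≤ m') :
    IsSmallFraction D m' x := by
  obtain ⟨z, h1, h2⟩ := h
  exact ⟨z, h1, h2.trans_le (pow_le_pow_right₀ (by norm_num) hm)⟩

theorem isSmallFraction_zero (D m : ℕ) : IsSmallFraction D m 0 := ⟨0, by simp, by simp⟩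

theorem IsSmallFraction.add {D m : ℕ} {x y : ℚ} (hx : IsSmallFraction D m x)
    (hy : IsSmallFraction D m y) : IsSmallFraction D (m + 1) (x + y) := by
  obtain ⟨z, h1, h2⟩ := hx
  obtain ⟨z', h1', h2'⟩ := hy
  refine ⟨z + z', by push_cast; rw [add_mul, h1, h1'], (abs_add_le _ _).trans_lt ?_⟩
  rw [pow_succ]; linarith

theorem IsSmallFraction.sub {D m : ℕ} {x y : ℚ} (hx : IsSmallFraction D m x)
    (hy : IsSmallFraction D m y) : IsSmallFraction D (m + 1) (x - y) := by
  obtain ⟨z, h1, h2⟩ := hx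
  obtain ⟨z', h1', h2'⟩ := hy
  refine ⟨z - z', by push_cast; rw [sub_mul, h1, h1'], (abs_sub _ _).trans_lt ?_⟩
  rw [pow_succ]; linarith

/-- In lowest terms the numerator divides `z` and the denominator divides `D`. -/
theorem IsSmallFraction.ratLength_le {D m : ℕ} (hD : 0 < D) {x : ℚ}
    (h : IsSmallFraction D m x) : ratLength x ≤ m + Nat.size D := by
  obtain ⟨z, h1, h2⟩ := h
  have hD' : (D : ℚ) ≠ 0 := by exact_mod_cast hD.ne'
  have hx : x = Rat.divInt z D := by
    rw [Rat.divInt_eq_div]; field_simp; exact_mod_cast h1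
  have hden : x.den ∣ D := by
    have := Rat.den_dvd z D
    rw [← hx] at this
    exact_mod_cast this
  have hnum : x.num ∣ z := by
    rw [hx]; exact Rat.num_dvd z (by exact_mod_cast hD.ne')
  refine Nat.add_le_add ?_ (Nat.size_le_size (Nat.le_of_dvd hD hden))
  rw [Nat.size_le]
  rcases eq_or_ne z 0 with rfl | hz
  · have : x.num = 0 := by
      have : x = 0 := by simpa [hD'] using h1
      simp [this]
    simp [this]
  · have h3 : x.num.natAbs ≤ z.natAbs := Nat.le_of_dvd (Int.natAbs_pos.2 hz)
      (Int.natAbs_dvd_natAbs.2 hnum)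
    have h4 : (z.natAbs : ℤ) < 2 ^ m := by rwa [Int.natCast_natAbs]
    exact h3.trans_lt (by exact_mod_cast h4)

section

variable {D m : ℕ} {σ : State ℚ}

/-- An addition at most doubles the larger operand, so every operation accounts for at most one more
bit. -/
theorem NatExp.eval_lt (hσ : σ.Small D m) (e : NatExp) (he : e.maxLit < 2 ^ m) :
    e.eval σ < 2 ^ (m + e.ops) := by
  induction e with
  | lit k => exact he.trans_le (Nat.pow_le_pow_right (by norm_num) (by omega))
  | get a i ih => exact (hσ.nat _ _).trans_le (Nat.pow_le_pow_right (by norm_num) (by omega))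
  | plus e f ihe ihf =>
    simp only [NatExp.maxLit, max_lt_iff] at he
    have h1 := (ihe he.1).trans_le
      (Nat.pow_le_pow_right (n := 2) (by norm_num) (by omega : m + e.ops ≤ m + (e.ops + f.ops)))
    have h2 := (ihf he.2).trans_le
      (Nat.pow_le_pow_right (n := 2) (by norm_num) (by omega : m + f.ops ≤ m + (e.ops + f.ops)))
    simp only [NatExp.eval, NatExp.ops]
    rw [← add_assoc m, pow_succ]
    omega
  | minus e f ihe ihf =>
    simp only [NatExp.maxLit, max_lt_iff] at he
    simp only [NatExp.eval, NatExp.ops]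
    exact (Nat.sub_le _ _).trans_lt ((ihe he.1).trans_le
      (Nat.pow_le_pow_right (by norm_num) (by omega)))

theorem NumExp.eval_small (hσ : σ.Small D m) (e : NumExp) :
    IsSmallFraction D (m + e.ops) (e.eval σ) := by
  induction e with
  | zero => exact isSmallFraction_zero _ _
  | get a i => exact (hσ.num _ _).mono (by omega)
  | plus e f ihe ihf =>
    exact ((ihe.mono (by omega)).add (ihf.mono (by omega : _ ≤ m + e.ops + f.ops))).mono
      (by simp only [NumExp.ops]; omega)
  | minus e f ihe ihf =>
    exact ((ihe.mono (by omega)).sub (ihf.mono (by omega : _ ≤ m + e.ops + f.ops))).mono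
      (by simp only [NumExp.ops]; omega)

theorem bitCost_nat_le {k M : ℕ} (h : k < 2 ^ M) : (bitCost.nat k) ≤ M + 1 := by
  simp only [bitCost, add_le_add_iff_right]
  exact Nat.size_le.2 h

theorem bitCost_num_le (hD : 0 < D) {x : ℚ} {M : ℕ} (h : IsSmallFraction D M x) :
    (bitCost.num x) ≤ M + Nat.size D + 1 := by
  simp only [bitCost, add_le_add_iff_right]
  exact h.ratLength_le hD

theorem NatExp.bitCost_le (hσ : σ.Small D m) (e : NatExp) (he : e.maxLit < 2 ^ m) {L : ℕ}
    (hL : m + e.ops + 1 ≤ L) : e.cost bitCost σ ≤ e.ops * L := by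
  induction e with
  | lit k =>
    have h := bitCost_nat_le he
    simp only [NatExp.maxLit, NatExp.cost, NatExp.ops] at h hL ⊢
    omega
  | get a i ih =>
    simp only [NatExp.ops] at hL
    simp only [NatExp.cost, NatExp.ops, Nat.succ_mul]
    have := bitCost_nat_le (hσ.nat a (i.eval σ))
    have := ih he (by omega)
    omega
  | plus e f ihe ihf =>
    have h := bitCost_nat_le (NatExp.eval_lt hσ _ he)
    simp only [NatExp.maxLit, max_lt_iff] at he
    simp only [NatExp.ops] at hL
    have := ihe he.1 (by omega)
    have := ihf he.2 (by omega)
    simp only [NatExp.cost, NatExp.ops, Nat.succ_mul, Nat.add_mul, NatExp.eval] at h ⊢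
    omega
  | minus e f ihe ihf =>
    have h := bitCost_nat_le (NatExp.eval_lt hσ _ he)
    simp only [NatExp.maxLit, max_lt_iff] at he
    simp only [NatExp.ops] at hL
    have := ihe he.1 (by omega)
    have := ihf he.2 (by omega)
    simp only [NatExp.cost, NatExp.ops, Nat.succ_mul, Nat.add_mul, NatExp.eval] at h ⊢
    omega

theorem NumExp.bitCost_le (hD : 0 < D) (hσ : σ.Small D m) (e : NumExp) (he : e.maxLit < 2 ^ m)
    {L : ℕ} (hL : m + e.ops + Nat.size D + 1 ≤ L) : e.cost bitCost σ ≤ e.ops * L := by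
  induction e with
  | zero =>
    have h := bitCost_num_le hD (NumExp.eval_small hσ .zero)
    simp only [NumExp.cost, NumExp.ops, NumExp.eval] at h hL ⊢
    omega
  | get a i =>
    simp only [NumExp.ops] at hL
    simp only [NumExp.cost, NumExp.ops, Nat.succ_mul]
    have := bitCost_num_le hD (hσ.num a (i.eval σ))
    have := NatExp.bitCost_le hσ i he (L := L) (by omega)
    omega
  | plus e f ihe ihf =>
    have h := bitCost_num_le hD (NumExp.eval_small hσ (.plus e f))
    simp only [NumExp.maxLit, max_lt_iff] at he
    simp only [NumExp.ops] at hL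
    have := ihe he.1 (by omega)
    have := ihf he.2 (by omega)
    simp only [NumExp.cost, NumExp.ops, Nat.succ_mul, Nat.add_mul, NumExp.eval] at h ⊢
    omega
  | minus e f ihe ihf =>
    have h := bitCost_num_le hD (NumExp.eval_small hσ (.minus e f))
    simp only [NumExp.maxLit, max_lt_iff] at he
    simp only [NumExp.ops] at hL
    have := ihe he.1 (by omega)
    have := ihf he.2 (by omega)
    simp only [NumExp.cost, NumExp.ops, Nat.succ_mul, Nat.add_mul, NumExp.eval] at h ⊢
    omega

theorem Test.bitCost_le (hD : 0 < D) (hσ : σ.Small D m) (b : Test) (hb : b.maxLit < 2 ^ m)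
    {L : ℕ} (hL : m + b.ops + Nat.size D + 1 ≤ L) : b.cost bitCost σ ≤ b.ops * L := by
  induction b with
  | natLe e f =>
    simp only [Test.maxLit, max_lt_iff] at hb
    simp only [Test.ops] at hL
    have := NatExp.bitCost_le hσ e hb.1 (L := L) (by omega)
    have := NatExp.bitCost_le hσ f hb.2 (L := L) (by omega)
    simp only [Test.cost, Test.ops, Nat.succ_mul, Nat.add_mul]
    omega
  | numLe e f =>
    simp only [Test.maxLit, max_lt_iff] at hb
    simp only [Test.ops] at hL
    have := NumExp.bitCost_le hD hσ e hb.1 (L := L) (by omega)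
    have := NumExp.bitCost_le hD hσ f hb.2 (L := L) (by omega)
    simp only [Test.cost, Test.ops, Nat.succ_mul, Nat.add_mul]
    omega
  | neg b ih =>
    simp only [Test.ops] at hL
    have := ih hb (by omega)
    simp only [Test.cost, Test.ops, Nat.succ_mul]
    omega
  | conj b c ihb ihc =>
    simp only [Test.maxLit, max_lt_iff] at hb
    simp only [Test.ops] at hL
    have := ihb hb.1 (by omega)
    have := ihc hb.2 (by omega)
    simp only [Test.cost, Test.ops, Nat.succ_mul, Nat.add_mul]
    omega

theorem State.Small.mono {m' : ℕ} (hσ : σ.Small D m) (hm : m ≤ m') : σ.Small D m' :=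
  ⟨fun a i => (hσ.nat a i).trans_le (Nat.pow_le_pow_right (by norm_num) hm),
    fun a i => (hσ.num a i).mono hm⟩

theorem State.Small.writeNat (hσ : σ.Small D m) (a i : ℕ) {x : ℕ} (hx : x < 2 ^ m) :
    (σ.writeNat a i x).Small D m := by
  refine ⟨fun b j => ?_, hσ.num⟩
  simp only [State.writeNat]
  split_ifs
  exacts [hx, hσ.nat b j]

theorem State.Small.writeNum (hσ : σ.Small D m) (a i : ℕ) {x : ℚ} (hx : IsSmallFraction D m x) :
    (σ.writeNum a i x).Small D m := by
  refine ⟨hσ.nat, fun b j => ?_⟩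
  simp only [State.writeNum]
  split_ifs
  exacts [hx, hσ.num b j]

end

/-- A computation with `t` operations on numbers of size `m` costs at most `t` times about
`m + t` bit operations. -/
theorem Exec.bitCost {D : ℕ} (hD : 0 < D) {P : Program} {σ τ : State ℚ} {t : ℕ}
    (h : Exec (unitCost ℚ) P σ τ t) :
    ∀ {m : ℕ}, σ.Small D m → P.maxLit < 2 ^ m → τ.Small D (m + t) ∧
      ∀ L, m + t + Nat.size D + 1 ≤ L → ∃ t', Exec bitCost P σ τ t' ∧ t' ≤ t * L := by
  induction h with
  | skip σ =>
    exact fun hσ _ => ⟨hσ.mono (by omega), fun L hL => ⟨_, .skip σ, by omega⟩⟩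
  | setNat a i e σ =>
    intro m hσ hP
    simp only [Program.maxLit, max_lt_iff] at hP
    simp only [NatExp.cost_unitCost]
    refine ⟨(hσ.mono (by omega)).writeNat _ _ ((NatExp.eval_lt hσ e hP.2).trans_le
      (Nat.pow_le_pow_right (by norm_num) (by omega))), fun L hL => ⟨_, .setNat a i e σ, ?_⟩⟩
    have := NatExp.bitCost_le hσ i hP.1 (L := L) (by omega)
    have := NatExp.bitCost_le hσ e hP.2 (L := L) (by omega)
    simp only [Nat.succ_mul, Nat.add_mul]
    omega
  | setNum a i e σ =>
    intro m hσ hP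
    simp only [Program.maxLit, max_lt_iff] at hP
    simp only [NatExp.cost_unitCost, NumExp.cost_unitCost]
    refine ⟨(hσ.mono (by omega)).writeNum _ _ ((NumExp.eval_small hσ e).mono (by omega)),
      fun L hL => ⟨_, .setNum a i e σ, ?_⟩⟩
    have := NatExp.bitCost_le hσ i hP.1 (L := L) (by omega)
    have := NumExp.bitCost_le hD hσ e hP.2 (L := L) (by omega)
    simp only [Nat.succ_mul, Nat.add_mul]
    omega
  | @seq P Q σ₁ σ₂ σ₃ t₁ t₂ h₁ h₂ ih₁ ih₂ =>
    intro m hσ hP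
    simp only [Program.maxLit, max_lt_iff] at hP
    obtain ⟨hs₁, hb₁⟩ := ih₁ hσ hP.1
    -- The first program may have lengthened the numbers by `t₁` bits, so the second starts at size
    -- `m + t₁`.
    obtain ⟨hs₂, hb₂⟩ := ih₂ hs₁ (hP.2.trans_le (Nat.pow_le_pow_right (by norm_num) (by omega)))
    refine ⟨hs₂.mono (by omega), fun L hL => ?_⟩
    obtain ⟨t₁', he₁, hl₁⟩ := hb₁ L (by omega)
    obtain ⟨t₂', he₂, hl₂⟩ := hb₂ L (by omega)
    exact ⟨_, he₁.seq he₂, by rw [Nat.add_mul]; omega⟩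
  | @branch_true b P Q σ τ t hb h ih =>
    intro m hσ hP
    simp only [Program.maxLit, max_lt_iff] at hP
    rw [Test.cost_unitCost]
    obtain ⟨hs, hc⟩ := ih hσ hP.2.1
    refine ⟨hs.mono (by omega), fun L hL => ?_⟩
    obtain ⟨t', he, hl⟩ := hc L (by omega)
    have := Test.bitCost_le hD hσ b hP.1 (L := L) (by omega)
    exact ⟨_, he.branch_true hb, by rw [Nat.add_mul]; omega⟩
  | @branch_false b P Q σ τ t hb h ih =>
    intro m hσ hP
    simp only [Program.maxLit, max_lt_iff] at hP
    rw [Test.cost_unitCost]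
    obtain ⟨hs, hc⟩ := ih hσ hP.2.2
    refine ⟨hs.mono (by omega), fun L hL => ?_⟩
    obtain ⟨t', he, hl⟩ := hc L (by omega)
    have := Test.bitCost_le hD hσ b hP.1 (L := L) (by omega)
    exact ⟨_, he.branch_false hb, by rw [Nat.add_mul]; omega⟩
  | @loop_true b P σ₁ σ₂ σ₃ t₁ t₂ hb h₁ h₂ ih₁ ih₂ =>
    intro m hσ hP
    have hP' := hP
    simp only [Program.maxLit, max_lt_iff] at hP'
    rw [Test.cost_unitCost]
    obtain ⟨hs₁, hb₁⟩ := ih₁ hσ hP'.2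
    obtain ⟨hs₂, hb₂⟩ := ih₂ hs₁ (hP.trans_le (Nat.pow_le_pow_right (by norm_num) (by omega)))
    refine ⟨hs₂.mono (by omega), fun L hL => ?_⟩
    obtain ⟨t₁', he₁, hl₁⟩ := hb₁ L (by omega)
    obtain ⟨t₂', he₂, hl₂⟩ := hb₂ L (by omega)
    have := Test.bitCost_le hD hσ b hP'.1 (L := L) (by omega)
    exact ⟨_, he₁.loop_true hb he₂, by rw [Nat.add_mul, Nat.add_mul]; omega⟩
  | @loop_false b P σ hb =>
    intro m hσ hP
    simp only [Program.maxLit, max_lt_iff] at hP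
    rw [Test.cost_unitCost]
    refine ⟨hσ.mono (by omega), fun L hL => ⟨_, .loop_false hb, ?_⟩⟩
    exact Test.bitCost_le hD hσ b hP.1 (by omega)

end AddRAM

/-! ### Bit length of the input -/

namespace BISInstance

open AddRAM

variable {n : ℕ} (I : BISInstance ℚ n)

/-- A common denominator of all the weights. -/
def commonDenominator : ℕ := ∏ v, ((I.leaderWeight v).den * (I.followerWeight v).den)

theorem commonDenominator_pos : 0 < I.commonDenominator :=
  Finset.prod_pos fun _ _ => Nat.mul_pos (Rat.den_pos _) (Rat.den_pos _)

theorem _root_.Nat.size_mul_le (a b : ℕ) : Nat.size (a * b) ≤ Nat.size a + Nat.size b := by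
  rw [Nat.size_le, pow_add]
  exact Nat.mul_lt_mul'' (Nat.lt_size_self a) (Nat.lt_size_self b)

/-- Lengths are subadditive under products; the extra `1` is the length of the empty product. -/
theorem size_commonDenominator_le : Nat.size I.commonDenominator ≤ I.bitLength + 1 := by
  have key : ∀ s : Finset (Fin n),
      Nat.size (∏ v ∈ s, ((I.leaderWeight v).den * (I.followerWeight v).den)) ≤
        ∑ v ∈ s, (ratLength (I.leaderWeight v) + ratLength (I.followerWeight v)) + 1 := by
    intro s
    induction s using Finset.induction_on with
    | empty => simp
    | insert v s hv ih =>
      rw [Finset.prod_insert hv, Finset.sum_insert hv]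
      refine (Nat.size_mul_le _ _).trans ?_
      have := Nat.size_mul_le (I.leaderWeight v).den (I.followerWeight v).den
      simp only [ratLength] at ih ⊢
      omega
  have := key Finset.univ
  simp only [commonDenominator, bitLength]
  omega

/-- Over the denominator `D` the numerator is `x.num` times the cofactor `k`, and each of the two
has length at most `M`. -/
theorem isSmallFraction_of_dvd {D M : ℕ} {x : ℚ} (hx : x.den ∣ D) (hD : Nat.size D ≤ M)
    (hl : ratLength x ≤ M) : IsSmallFraction D (2 * M) x := by
  obtain ⟨k, rfl⟩ := hx
  refine ⟨x.num * k, ?_, ?_⟩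
  · push_cast
    rw [← mul_assoc, Rat.mul_den_eq_num]
  · have hk : Nat.size k ≤ M := by
      rcases Nat.eq_zero_or_pos k with rfl | hk
      · simp
      · exact (Nat.size_le_size (Nat.le_mul_of_pos_left k x.den_pos)).trans hD
    have hn : Nat.size x.num.natAbs ≤ M := by simp only [ratLength] at hl; omega
    rw [Nat.size_le] at hk hn
    have := Nat.mul_lt_mul'' hn hk
    rw [abs_mul, two_mul, pow_add, ← Int.natCast_natAbs, Nat.abs_cast]
    exact_mod_cast this

theorem encode_small : I.encode.Small I.commonDenominator (2 * (I.bitLength + 1)) := by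
  have hn : n ≤ I.bitLength := by simp [bitLength]
  have hlen : ∀ v, ratLength (I.leaderWeight v) + ratLength (I.followerWeight v) ≤ I.bitLength := by
    intro v
    have := Finset.single_le_sum
      (f := fun v => ratLength (I.leaderWeight v) + ratLength (I.followerWeight v))
      (fun _ _ => Nat.zero_le _) (Finset.mem_univ v)
    simp only [bitLength]
    omega
  have hdvd : ∀ v, (I.leaderWeight v).den * (I.followerWeight v).den ∣ I.commonDenominator :=
    fun v => Finset.dvd_prod_of_mem
      (fun v => (I.leaderWeight v).den * (I.followerWeight v).den) (Finset.mem_univ v)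
  have h1 : 1 < 2 ^ (2 * (I.bitLength + 1)) := Nat.one_lt_two_pow (by omega)
  refine ⟨fun a i => ?_, fun a i => ?_⟩
  · simp only [encode]
    have h2 : n < 2 ^ (2 * (I.bitLength + 1)) :=
      Nat.lt_two_pow_self.trans_le (Nat.pow_le_pow_right (by norm_num) (by omega))
    split_ifs <;> omega
  · simp only [encode]
    split_ifs with hi h0 h1
    · exact isSmallFraction_of_dvd ((Dvd.intro _ rfl).trans (hdvd ⟨i, hi⟩))
        I.size_commonDenominator_le (by have := hlen ⟨i, hi⟩; omega)
    · exact isSmallFraction_of_dvd ((Dvd.intro_left _ rfl).trans (hdvd ⟨i, hi⟩))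
        I.size_commonDenominator_le (by have := hlen ⟨i, hi⟩; omega)
    · exact isSmallFraction_zero _ _
    · exact isSmallFraction_zero _ _

/-- Polynomially many operations take polynomially many bit operations. -/
theorem exists_bitCost_bound (P : Program) (p : Polynomial ℕ)
    (h : ∀ (n : ℕ) (I : BISInstance ℚ n), 0 < n → I.graph.IsBipartite →
      I.SolvedWithin P (unitCost ℚ) (p.eval n)) :
    ∃ q : Polynomial ℕ, ∀ (n : ℕ) (I : BISInstance ℚ n), 0 < n → I.graph.IsBipartite →
      I.SolvedWithin P bitCost (q.eval I.bitLength) := by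
  -- Number of operations times the length bound `L` of `Exec.bitCost`: the initial size, enlarged
  -- to cover the literals, one bit per operation, and the length of the denominator.
  refine ⟨p * (2 * (Polynomial.X + 1) + Polynomial.C P.maxLit + p + (Polynomial.X + 1) + 1),
    fun n I hn hI => ?_⟩
  obtain ⟨τ, t, he, ht, hs⟩ := h n I hn hI
  have hmono : p.eval n ≤ p.eval I.bitLength := by
    simp only [Polynomial.eval_eq_sum_range]
    have : n ≤ I.bitLength := by simp [bitLength]
    gcongr
  obtain ⟨-, hb⟩ := he.bitCost I.commonDenominator_pos
    (m := 2 * (I.bitLength + 1) + P.maxLit) (I.encode_small.mono (by omega))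
    (Nat.lt_two_pow_self.trans_le (Nat.pow_le_pow_right (by norm_num) (by omega)))
  obtain ⟨t', he', ht'⟩ := hb (2 * (I.bitLength + 1) + P.maxLit + p.eval I.bitLength +
    (I.bitLength + 1) + 1) (by have := I.size_commonDenominator_le; omega)
  refine ⟨τ, t', he', ht'.trans ?_, hs⟩
  simp only [Polynomial.eval_mul, Polynomial.eval_add, Polynomial.eval_X, Polynomial.eval_one,
    Polynomial.eval_C, Polynomial.eval_ofNat]
  exact Nat.mul_le_mul_right _ (ht.trans hmono)

end BISInstance

/-! ### Preflows in a bipartite graph -/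

/-! ### Push-relabel method and duality -/

section preflow

set_option linter.unusedSectionVars false

variable {K : Type} [Field K] [LinearOrder K] [IsStrictOrderedRing K]
  {V : Type} [Fintype V] [DecidableEq V]

/-- A preflow `f` with excess `g` and distance labels `d`, from the vertices `v` with `c v = true`,
which supply `w v`, along the arcs `E` to the other vertices, which demand `w v`. -/
structure IsPreflow (E : V → V → Prop) (c : V → Bool) (w : V → K) (N : ℕ)
    (f : V → V → K) (g : V → K) (d : V → ℕ) : Prop where
  nonneg : ∀ a b, 0 ≤ f a b
  supp : ∀ a b, f a b ≠ 0 → E a b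
  -- For a supplier `g` is the supply not yet sent; for a demander it is the inflow beyond the
  -- demand, negative as long as the demand is unmet.
  excess : ∀ v, w v = ∑ b, f v b + ∑ a, f a v + if c v = true then g v else -g v
  source_nonneg : ∀ a, c a = true → 0 ≤ g a
  -- This and the next two conditions make `d` a lower bound for the residual distance to a deficit
  -- vertex. Arcs of `E` have unlimited capacity and are always residual; a reverse arc is residual
  -- when it carries flow.
  label_eq_zero : ∀ v, g v < 0 → d v = 0
  label_forward : ∀ a b, E a b → d a ≤ d b + 1
  label_backward : ∀ a b, 0 < f a b → d b ≤ d a + 1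
  label_le : ∀ v, d v ≤ N

/-- The flow after pushing `x` units along the arc from `a` to `b`. -/
def pushFlow (f : V → V → K) (a b : V) (x : K) : V → V → K :=
  fun u v => f u v + if u = a ∧ v = b then x else 0

/-- The excess after pushing `x` units along the arc from `a` to `b`. -/
def pushExcess (g : V → K) (a b : V) (x : K) : V → K :=
  fun v => g v - (if v = a then x else 0) + if v = b then x else 0

/-- A negative `x` sends `-x` units back from `b` to `a`; `hgb` then prevents a new deficit at `b`.
Only a positive `x` can create a residual reverse arc, whose label condition is `hd`. -/
theorem IsPreflow.push {E : V → V → Prop} {c : V → Bool} {w : V → K} {N : ℕ}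
    {f : V → V → K} {g : V → K} {d : V → ℕ} (h : IsPreflow E c w N f g d)
    {a b : V} (ha : c a = true) (hb : c b = false) (hE : E a b) {x : K} (hf : 0 ≤ f a b + x)
    (hg : 0 ≤ g a - x) (hgb : x < 0 → 0 ≤ g b + x) (hd : 0 < x → d b ≤ d a + 1) :
    IsPreflow E c w N (pushFlow f a b x) (pushExcess g a b x) d where
  nonneg u v := by
    unfold pushFlow
    split_ifs with huv
    · rw [huv.1, huv.2]; exact hf
    · simpa using h.nonneg u v
  supp u v huv := by
    by_cases h' : u = a ∧ v = b
    · rw [h'.1, h'.2]; exact hE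
    · exact h.supp u v (by simpa [pushFlow, h'] using huv)
  excess v := by
    have hab : a ≠ b := by rintro rfl; simp [ha] at hb
    rw [h.excess v]
    simp only [pushFlow, pushExcess, Finset.sum_add_distrib, ite_and]
    by_cases hva : v = a
    · subst hva
      simp only [ha, hab, if_true, if_false, Finset.sum_ite_eq', Finset.mem_univ,
        Finset.sum_const_zero, ite_self]
      ring
    · by_cases hvb : v = b
      · subst hvb
        simp [hva, hb]
        ring
      · simp [hva, hvb]
  source_nonneg v hv := by
    have hvb : v ≠ b := by rintro rfl; simp [hv] at hb
    by_cases hva : v = a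
    · subst hva; simpa [pushExcess, hvb] using hg
    · simpa [pushExcess, hvb, hva] using h.source_nonneg v hv
  label_eq_zero v hv := by
    have hab : a ≠ b := by rintro rfl; simp [ha] at hb
    by_cases hva : v = a
    · subst hva
      simp only [pushExcess, hab, if_true, if_false, add_zero] at hv
      exact absurd hv (not_lt.2 hg)
    · by_cases hvb : v = b
      · subst hvb
        simp only [pushExcess, hva, if_true, if_false, sub_zero] at hv
        refine h.label_eq_zero v ?_
        by_contra h0
        rcases lt_or_ge x 0 with hx | hx
        · exact absurd hv (not_lt.2 (hgb hx))
        · linarith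
      · exact h.label_eq_zero v (by simpa [pushExcess, hva, hvb] using hv)
  label_forward := h.label_forward
  label_backward u v huv := by
    by_cases h' : u = a ∧ v = b
    · rw [h'.1, h'.2] at huv ⊢
      rcases lt_or_ge 0 x with hx | hx
      · exact hd hx
      · refine h.label_backward a b (huv.trans_le ?_)
        simpa [pushFlow] using hx
    · exact h.label_backward u v (by simpa [pushFlow, h'] using huv)
  label_le := h.label_le

/-- If no residual arc out of `u` is admissible, the label inequalities along these arcs are strict
and leave room for one more; along arcs into `u` the slack only grows. As `u` has positive excess,
it is not bound to label `0`. -/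
theorem IsPreflow.relabel {E : V → V → Prop} {c : V → Bool} {w : V → K} {N : ℕ}
    {f : V → V → K} {g : V → K} {d : V → ℕ} (h : IsPreflow E c w N f g d)
    (hEc : ∀ a b, E a b → c a = true ∧ c b = false)
    {u : V} (hu : 0 < g u) (hdu : d u < N)
    (hfwd : ∀ b, E u b → d u ≠ d b + 1) (hbwd : ∀ a, 0 < f a u → d u ≠ d a + 1) :
    IsPreflow E c w N f g (Function.update d u (d u + 1)) where
  nonneg := h.nonneg
  supp := h.supp
  excess := h.excess
  source_nonneg := h.source_nonneg
  label_eq_zero v hv := by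
    have : v ≠ u := by rintro rfl; exact absurd hu hv.asymm
    simpa [Function.update_of_ne this] using h.label_eq_zero v hv
  label_forward a b hab := by
    have hne : a ≠ b := by rintro rfl; simpa using (hEc _ _ hab).1.symm.trans (hEc _ _ hab).2
    have h1 := h.label_forward a b hab
    by_cases ha : a = u
    · subst ha
      have := hfwd b hab
      simp only [Function.update_self, Function.update_of_ne hne.symm]
      omega
    · by_cases hb : b = u
      · subst hb
        simp only [Function.update_self, Function.update_of_ne ha]
        omega
      · simpa only [Function.update_of_ne ha, Function.update_of_ne hb] using h1
  label_backward a b hab := by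
    have hE := h.supp a b hab.ne'
    have hne : a ≠ b := by rintro rfl; simpa using (hEc _ _ hE).1.symm.trans (hEc _ _ hE).2
    have h1 := h.label_backward a b hab
    by_cases ha : a = u
    · subst ha
      simp only [Function.update_self, Function.update_of_ne hne.symm]
      omega
    · by_cases hb : b = u
      · subst hb
        have := hbwd a hab
        simp only [Function.update_self, Function.update_of_ne ha]
        omega
      · simpa only [Function.update_of_ne ha, Function.update_of_ne hb] using h1
  label_le v := by
    by_cases hv : v = u
    · subst hv; simpa using hdu
    · simpa [Function.update_of_ne hv] using h.label_le v

/-! ### Termination of the preflow method -/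

open Classical in
/-- The contribution of the pair `(a, b)` to the potential. -/
noncomputable def pairPotential (N : ℕ) (f : V → V → K) (d : V → ℕ) (p : V × V) : ℕ :=
  -- The alternative `d p.2 < d p.1` turns the indicator on already before a forward push, so that
  -- such a push cannot raise it.
  (N - d p.1) + (N - d p.2) + if 0 < f p.1 p.2 ∨ d p.2 < d p.1 then 1 else 0

/-- The total label of the active vertices. -/
def activeLabel (g : V → K) (d : V → ℕ) (v : V) : ℕ := if 0 < g v then d v else 0

/-- The coefficients balance three kinds of steps. Pushing a whole excess moves it to a label lower
by one and raises no pair term. Cancelling the flow on an arc switches off an indicator worth `N +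
1`, while the active labels gain at most `N`. A relabeling gains `2` in the middle sum and loses at
most `1` in the last; an indicator it switches on is paid for by `N - d` in the same pair. -/
noncomputable def preflowPotential (N : ℕ) (f : V → V → K) (g : V → K) (d : V → ℕ) : ℕ :=
  (N + 1) * ∑ p, pairPotential N f d p + 2 * ∑ v, (N - d v) + ∑ v, activeLabel g d v

theorem sum_add_le_sum_add_of_pair {h h' : V → ℕ} {a b : V} (hab : a ≠ b)
    (hrest : ∀ v, v ≠ a → v ≠ b → h' v ≤ h v) {x y : ℕ}
    (hp : h' a + h' b + x ≤ h a + h b + y) : ∑ v, h' v + x ≤ ∑ v, h v + y := by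
  have key : ∀ k : V → ℕ, ∑ v, k v = k a + k b + ∑ v ∈ (Finset.univ.erase a).erase b, k v := by
    intro k
    rw [← Finset.add_sum_erase _ _ (Finset.mem_univ a),
      ← Finset.add_sum_erase _ _ (Finset.mem_erase.2 ⟨hab.symm, Finset.mem_univ b⟩), add_assoc]
  rw [key h, key h']
  have : ∑ v ∈ (Finset.univ.erase a).erase b, h' v ≤ ∑ v ∈ (Finset.univ.erase a).erase b, h v := by
    refine Finset.sum_le_sum fun v hv => ?_
    simp only [Finset.mem_erase] at hv
    exact hrest v hv.2.1 hv.1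
  omega

theorem preflowPotential_le {N : ℕ} {f : V → V → K} {g : V → K} {d : V → ℕ}
    (hd : ∀ v, d v ≤ N) : preflowPotential N f g d ≤
      (N + 1) * (Fintype.card V * Fintype.card V * (2 * N + 1)) + 3 * (Fintype.card V * N) := by
  have h1 : ∑ p, pairPotential N f d p ≤ Fintype.card V * Fintype.card V * (2 * N + 1) := by
    rw [← Fintype.card_prod, ← smul_eq_mul]
    refine Finset.sum_le_card_nsmul _ _ _ fun p _ => ?_
    unfold pairPotential
    split_ifs <;> omega
  have h2 : ∑ v, (N - d v) ≤ Fintype.card V * N := by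
    rw [← smul_eq_mul]
    exact Finset.sum_le_card_nsmul _ _ _ fun v _ => by omega
  have h3 : ∑ v, activeLabel g d v ≤ Fintype.card V * N := by
    rw [← smul_eq_mul]
    refine Finset.sum_le_card_nsmul _ _ _ fun v _ => ?_
    have := hd v
    unfold activeLabel
    split_ifs <;> omega
  have := Nat.mul_le_mul_left (N + 1) h1
  unfold preflowPotential
  omega

/-- A push that gets rid of the whole excess lowers the potential. -/
theorem preflowPotential_push_forward {N : ℕ} {f : V → V → K} {g : V → K} {d : V → ℕ} {a b : V}
    (hab : a ≠ b) (hg : 0 < g a) (hd : d a = d b + 1) :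
    preflowPotential N (pushFlow f a b (g a)) (pushExcess g a b (g a)) d <
      preflowPotential N f g d := by
  have h1 : ∑ p, pairPotential N (pushFlow f a b (g a)) d p ≤ ∑ p, pairPotential N f d p := by
    refine Finset.sum_le_sum fun p _ => ?_
    by_cases hp : p.1 = a ∧ p.2 = b
    · have h2 : d p.2 < d p.1 := by rw [hp.1, hp.2]; omega
      simp [pairPotential, h2]
    · simp [pairPotential, pushFlow, hp]
  -- The label `d b + 1` of `a` leaves the sum, and at most the label `d b` enters it.
  have h2 : ∑ v, activeLabel (pushExcess g a b (g a)) d v + 1 ≤ ∑ v, activeLabel g d v + 0 := by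
    refine sum_add_le_sum_add_of_pair hab (fun v hva hvb => ?_) ?_
    · simp [activeLabel, pushExcess, hva, hvb]
    · simp only [activeLabel, pushExcess, hab, hab.symm, hg, if_true, if_false]
      split_ifs <;> (simp_all <;> omega)
  have := Nat.mul_le_mul_left (N + 1) h1
  unfold preflowPotential
  omega

/-- As for a forward push; the indicator of `(a, b)` is on beforehand because the arc carries flow.
-/
theorem preflowPotential_push_backward {N : ℕ} {f : V → V → K} {g : V → K} {d : V → ℕ} {a b : V}
    (hab : a ≠ b) (hg : 0 < g b) (hgf : g b ≤ f a b) (hd : d b = d a + 1) :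
    preflowPotential N (pushFlow f a b (-g b)) (pushExcess g a b (-g b)) d <
      preflowPotential N f g d := by
  have h1 : ∑ p, pairPotential N (pushFlow f a b (-g b)) d p ≤ ∑ p, pairPotential N f d p := by
    refine Finset.sum_le_sum fun p _ => ?_
    by_cases hp : p.1 = a ∧ p.2 = b
    · have h2 : 0 < f p.1 p.2 := by rw [hp.1, hp.2]; linarith
      unfold pairPotential
      rw [if_pos (Or.inl h2)]
      split_ifs <;> omega
    · simp [pairPotential, pushFlow, hp]
  have h2 : ∑ v, activeLabel (pushExcess g a b (-g b)) d v + 1 ≤ ∑ v, activeLabel g d v + 0 := by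
    refine sum_add_le_sum_add_of_pair hab (fun v hva hvb => ?_) ?_
    · simp [activeLabel, pushExcess, hva, hvb]
    · simp only [activeLabel, pushExcess, hab, hab.symm, hg, if_true, if_false]
      split_ifs <;> (simp_all <;> omega)
  have := Nat.mul_le_mul_left (N + 1) h1
  unfold preflowPotential
  omega

/-- A push that cancels the whole flow along an arc lowers the potential. -/
theorem preflowPotential_push_cancel {N : ℕ} {f : V → V → K} {g : V → K} {d : V → ℕ} {a b : V}
    (hab : a ≠ b) (hf : 0 < f a b) (hgf : f a b < g b) (hd : d b = d a + 1) (hN : d a ≤ N) :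
    preflowPotential N (pushFlow f a b (-f a b)) (pushExcess g a b (-f a b)) d <
      preflowPotential N f g d := by
  have h1 : ∑ p, pairPotential N (pushFlow f a b (-f a b)) d p < ∑ p, pairPotential N f d p := by
    refine Finset.sum_lt_sum (fun p _ => ?_) ⟨(a, b), Finset.mem_univ _, ?_⟩
    · by_cases hp : p.1 = a ∧ p.2 = b
      · have h2 : 0 < f p.1 p.2 := by rw [hp.1, hp.2]; linarith
        unfold pairPotential
        rw [if_pos (Or.inl h2)]
        split_ifs <;> omega
      · simp [pairPotential, pushFlow, hp]
    · have h3 : ¬ d b < d a := by omega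
      simp [pairPotential, pushFlow, hf, h3]
  have h2 : ∑ v, activeLabel (pushExcess g a b (-f a b)) d v + 0 ≤ ∑ v, activeLabel g d v + N := by
    refine sum_add_le_sum_add_of_pair hab (fun v hva hvb => ?_) ?_
    · simp [activeLabel, pushExcess, hva, hvb]
    · have h3 : 0 < g b := hf.trans hgf
      simp only [activeLabel, h3, if_true]
      split_ifs <;> omega
  have := Nat.mul_le_mul_left (N + 1) (Nat.succ_le_of_lt h1)
  rw [Nat.succ_eq_add_one, mul_add] at this
  unfold preflowPotential
  omega

theorem preflowPotential_relabel {N : ℕ} {f : V → V → K} {g : V → K} {d : V → ℕ} {u : V}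
    (hd : d u < N) (hf : ∀ v, ¬ 0 < f v v) :
    preflowPotential N f g (Function.update d u (d u + 1)) < preflowPotential N f g d := by
  have h1 : ∑ p, pairPotential N f (Function.update d u (d u + 1)) p ≤
      ∑ p, pairPotential N f d p := by
    refine Finset.sum_le_sum fun p _ => ?_
    obtain ⟨x, y⟩ := p
    unfold pairPotential
    by_cases hx : x = u
    · subst hx
      by_cases hy : y = x
      · subst hy
        simp [hf]; omega
      · simp only [Function.update_self, Function.update_of_ne hy]
        split_ifs <;> omega
    · by_cases hy : y = u
      · subst hy
        simp only [Function.update_self, Function.update_of_ne hx]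
        split_ifs <;> omega
      · simp only [Function.update_of_ne hx, Function.update_of_ne hy, le_refl]
  have h2 : ∑ v, (N - Function.update d u (d u + 1) v) < ∑ v, (N - d v) := by
    refine Finset.sum_lt_sum (fun v _ => ?_) ⟨u, Finset.mem_univ _, ?_⟩
    · by_cases hv : v = u
      · subst hv; simp; omega
      · simp [Function.update_of_ne hv]
    · simp; omega
  have h3 : ∑ v, activeLabel g (Function.update d u (d u + 1)) v ≤ ∑ v, activeLabel g d v + 1 := by
    have : ∑ v, activeLabel g (Function.update d u (d u + 1)) v ≤
        ∑ v, (activeLabel g d v + if v = u then 1 else 0) := by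
      refine Finset.sum_le_sum fun v _ => ?_
      unfold activeLabel
      by_cases hv : v = u
      · subst hv; split_ifs <;> simp_all
      · simp [hv]
    simpa [Finset.sum_add_distrib] using this
  have := Nat.mul_le_mul_left (N + 1) h1
  unfold preflowPotential
  omega

/-! ### The cut at an unused label -/

/-- The vertices left uncovered by the cut at the label `k`. -/
def cutSide (c : V → Bool) (d : V → ℕ) (k : ℕ) (v : V) : Prop :=
  (c v = true ∧ k < d v) ∨ (c v = false ∧ d v < k)

/-- With `x` the indicator of a set, this splits its weight into a flow part and an excess part, so
that two sets can be compared term by term. -/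
theorem IsPreflow.sum_mul {E : V → V → Prop} {c : V → Bool} {w : V → K} {N : ℕ}
    {f : V → V → K} {g : V → K} {d : V → ℕ} (h : IsPreflow E c w N f g d) (x : V → K) :
    ∑ v, x v * w v = ∑ a, ∑ b, f a b * (x a + x b) +
      ∑ v, x v * if c v = true then g v else -g v := by
  have h1 : ∑ a, ∑ b, f a b * (x a + x b) =
      ∑ v, x v * ∑ b, f v b + ∑ v, x v * ∑ a, f a v := by
    have h2 : ∑ v, x v * ∑ a, f a v = ∑ a, ∑ b, f a b * x b := by
      rw [Finset.sum_comm]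
      refine Finset.sum_congr rfl fun v _ => ?_
      rw [Finset.mul_sum]
      exact Finset.sum_congr rfl fun a _ => mul_comm _ _
    rw [h2, ← Finset.sum_add_distrib]
    refine Finset.sum_congr rfl fun v _ => ?_
    rw [Finset.mul_sum, ← Finset.sum_add_distrib]
    exact Finset.sum_congr rfl fun a _ => by ring
  rw [h1, ← Finset.sum_add_distrib, ← Finset.sum_add_distrib]
  refine Finset.sum_congr rfl fun v _ => ?_
  rw [h.excess v]
  ring

/-- An independent set is at most as heavy as the complement of the cut. -/
theorem IsPreflow.sum_le_cutSide {E : V → V → Prop} {c : V → Bool} {w : V → K} {N : ℕ}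
    {f : V → V → K} {g : V → K} {d : V → ℕ} (h : IsPreflow E c w N f g d)
    (hEc : ∀ a b, E a b → c a = true ∧ c b = false)
    (hN : ∀ v, 0 < g v → N ≤ d v) {k : ℕ} (hk : k < N) (hdk : ∀ v, d v ≠ k)
    (I J : Finset V) (hI : ∀ v, v ∈ I ↔ cutSide c d k v)
    (hJ : ∀ a ∈ J, ∀ b ∈ J, ¬ E a b) : ∑ v ∈ J, w v ≤ ∑ v ∈ I, w v := by
  have key : ∀ S : Finset V, ∑ v ∈ S, w v = ∑ v, (if v ∈ S then (1 : K) else 0) * w v := by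
    intro S; simp
  rw [key I, key J, h.sum_mul, h.sum_mul]
  -- Complementary slackness. On an arc with flow, `I` contains at least one end and `J` at most
  -- one. Suppliers with excess and demanders in deficit all lie in `I`, while demanders with
  -- positive excess, which count negatively, do not.
  refine add_le_add (Finset.sum_le_sum fun a _ => Finset.sum_le_sum fun b _ => ?_)
    (Finset.sum_le_sum fun v _ => ?_)
  · rcases (h.nonneg a b).eq_or_lt with h0 | h0
    · simp [← h0]
    · refine mul_le_mul_of_nonneg_left ?_ h0.le
      have hE := h.supp a b h0.ne'
      obtain ⟨ha, hb⟩ := hEc a b hE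
      have hlab := h.label_backward a b h0
      -- If `d a ≤ k`, then `d a < k` because `k` is unused; hence `d b ≤ k`, and again `d b < k`.
      have h1 : a ∈ I ∨ b ∈ I := by
        have := hdk a
        have := hdk b
        rcases lt_or_ge k (d a) with h2 | h2
        · exact Or.inl ((hI a).2 (Or.inl ⟨ha, h2⟩))
        · exact Or.inr ((hI b).2 (Or.inr ⟨hb, by omega⟩))
      have h2 : a ∈ J → b ∉ J := fun h3 h4 => hJ a h3 b h4 hE
      by_cases h3 : a ∈ J
      · rcases h1 with h1 | h1 <;> simp [h1, h3, h2 h3] <;> split_ifs <;> norm_num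
      · rcases h1 with h1 | h1 <;> simp [h1, h3] <;> split_ifs <;> norm_num
  · by_cases hc : c v = true
    · have h0 := h.source_nonneg v hc
      have h1 : 0 < g v → v ∈ I := fun hg =>
        (hI v).2 (Or.inl ⟨hc, hk.trans_le (hN v hg)⟩)
      rw [if_pos hc]
      rcases h0.eq_or_lt with h0 | h0
      · simp [← h0]
      · simp only [h1 h0, if_true]
        split_ifs <;> simp [h0.le]
    · have hc' : c v = false := by simpa using hc
      rw [if_neg hc]
      rcases lt_trichotomy (g v) 0 with h0 | h0 | h0
      · have h1 : v ∈ I := (hI v).2 (Or.inr ⟨hc', by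
          have := h.label_eq_zero v h0
          have := hdk v
          omega⟩)
        simp only [h1, if_true]
        split_ifs <;> simp [h0.le]
      · simp [h0]
      · have h1 : v ∉ I := by
          rw [hI]
          rintro (⟨h2, -⟩ | ⟨-, h2⟩)
          · exact hc h2
          · have := hN v h0
            omega
        simp only [h1, if_false]
        split_ifs <;> simp [h0.le]

/-- A supplier above `k` and a demander below `k` differ by at least two labels, more than an arc
allows. -/
theorem cutSide_independent {E : V → V → Prop} {c : V → Bool} {d : V → ℕ}
    (hEc : ∀ a b, E a b → c a = true ∧ c b = false) (hd : ∀ a b, E a b → d a ≤ d b + 1)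
    {k : ℕ} {a b : V} (ha : cutSide c d k a) (hb : cutSide c d k b) : ¬ E a b := by
  intro hE
  obtain ⟨hca, hcb⟩ := hEc a b hE
  have := hd a b hE
  rcases ha with ⟨-, ha⟩ | ⟨ha, -⟩
  · rcases hb with ⟨hb, -⟩ | ⟨-, hb⟩
    · simp [hb] at hcb
    · omega
  · simp [hca] at ha

end preflow

/-! ### Structure of optimal actions -/

namespace BISInstance

variable {K : Type} [Field K] [LinearOrder K] [IsStrictOrderedRing K] {n : ℕ}
  (I : BISInstance K n)

/-! ### Reactions of the follower -/

theorem leaderObjective_mono {S T : Finset (Fin n)} (h : S ⊆ T) :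
    I.leaderObjective S ≤ I.leaderObjective T :=
  Finset.sum_le_sum_of_subset_of_nonneg h fun v _ _ => I.leaderWeight_nonneg v

/-- The empty set is an optimal reaction to a nonempty action. -/
theorem isPessimisticReaction_empty {L : Finset (Fin n)} (hL : L.Nonempty)
    (hI : I.graph.IsIndepSet (↑L : Set (Fin n))) : I.IsPessimisticReaction L ∅ := by
  refine ⟨⟨⟨by simp, by simpa using hI, by simpa using hL⟩, fun F' _ => ?_⟩, fun F' _ => ?_⟩
  · rw [Finset.union_empty]
    exact Finset.inf_mono Finset.subset_union_left
  · exact I.leaderObjective_mono (by simp)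

theorem IsPessimisticReaction.isIndepSet {I : BISInstance K n} {L F : Finset (Fin n)}
    (h : I.IsPessimisticReaction L F) : I.graph.IsIndepSet (↑L : Set (Fin n)) :=
  Set.Pairwise.mono (by simp) h.1.1.2.1

theorem IsPessimisticReaction.leaderObjective_eq {I : BISInstance K n} {L F F' : Finset (Fin n)}
    (h : I.IsPessimisticReaction L F) (h' : I.IsPessimisticReaction L F') :
    I.leaderObjective (L ∪ F) = I.leaderObjective (L ∪ F') :=
  le_antisymm (h.2 F' h'.1) (h'.2 F h.1)

/-- All optimal pessimistic reactions to `L` give the leader the same value, and `∅` is one of them.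
-/
theorem IsPessimisticReaction.leaderObjective_eq_self {I : BISInstance K n} {L F : Finset (Fin n)}
    (hL : L.Nonempty) (h : I.IsPessimisticReaction L F) :
    I.leaderObjective (L ∪ F) = I.leaderObjective L := by
  simpa using h.leaderObjective_eq (I.isPessimisticReaction_empty hL h.isIndepSet)

/-- A follower vertex that the follower selects if the leader does nothing. -/
structure IsBestFollowerVertex (b : Fin n) : Prop where
  notMem : b ∉ I.leader
  max : ∀ v, v ∉ I.leader → I.followerWeight v ≤ I.followerWeight b
  min : ∀ v, v ∉ I.leader → I.followerWeight b ≤ I.followerWeight v →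
    I.leaderWeight b ≤ I.leaderWeight v

theorem exists_isBestFollowerVertex (h : ∃ v, v ∉ I.leader) : ∃ b, I.IsBestFollowerVertex b := by
  obtain ⟨v₀, hv₀⟩ := h
  obtain ⟨b₀, hb₀, hmax⟩ := Finset.exists_max_image I.leaderᶜ I.followerWeight ⟨v₀, by simpa⟩
  obtain ⟨b, hb, hmin⟩ := Finset.exists_min_image
    (I.leaderᶜ.filter fun v => I.followerWeight b₀ ≤ I.followerWeight v) I.leaderWeight
    ⟨b₀, by simpa using hb₀⟩
  simp only [Finset.mem_filter, Finset.mem_compl] at hb hmin hmax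
  exact ⟨b, hb.1, fun v hv => (hmax v hv).trans hb.2,
    fun v hv hbv => hmin v ⟨hv, hb.2.trans hbv⟩⟩

/-- Any vertex of a reaction bounds its minimum from above and its leader weight from below, so no
set does better than a single vertex in either objective. -/
theorem IsBestFollowerVertex.isPessimisticReaction {I : BISInstance K n} {b : Fin n}
    (h : I.IsBestFollowerVertex b) : I.IsPessimisticReaction ∅ {b} := by
  have hval : I.followerObjective (∅ ∪ {b}) = (I.followerWeight b : WithTop K) := by
    simp [followerObjective]
  refine ⟨⟨⟨by simpa using h.notMem, by simp, by simp⟩, fun F' hF' => ?_⟩, fun F' hF' => ?_⟩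
  · obtain ⟨hF, -, hne⟩ := hF'
    rw [Finset.empty_union] at hne
    obtain ⟨v, hv⟩ := hne
    rw [hval, Finset.empty_union]
    exact (Finset.inf_le hv).trans
      (WithTop.coe_le_coe.2 (h.max v (by simpa using hF hv)))
  · obtain ⟨⟨hF, -, hne⟩, hmax⟩ := hF'
    rw [Finset.empty_union] at hne
    obtain ⟨v, hv⟩ := hne
    have hb := hmax {b} ⟨by simpa using h.notMem, by simp, by simp⟩
    rw [hval, Finset.empty_union] at hb
    have hbv := WithTop.coe_le_coe.1 (hb.trans (Finset.inf_le hv))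
    calc I.leaderObjective (∅ ∪ {b}) = I.leaderWeight b := by simp [leaderObjective]
      _ ≤ I.leaderWeight v := h.min v (by simpa using hF hv) hbv
      _ = I.leaderObjective {v} := by simp [leaderObjective]
      _ ≤ I.leaderObjective (∅ ∪ F') := I.leaderObjective_mono (by simpa using hv)

/-! ### Optimal actions of the leader -/

theorem exists_notMem_of_isSuitableReaction_empty {I : BISInstance K n} {F : Finset (Fin n)}
    (h : I.IsSuitableReaction ∅ F) : ∃ v, v ∉ I.leader := by
  obtain ⟨hF, -, v, hv⟩ := h
  rw [Finset.empty_union] at hv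
  exact ⟨v, by simpa using hF hv⟩

theorem IsBestFollowerVertex.isOptimalSolution {I : BISInstance K n} {b : Fin n}
    (h : I.IsBestFollowerVertex b) {M : Finset (Fin n)} (hM : I.IsMaxWeightLeaderIndepSet M)
    (hle : I.leaderObjective M ≤ I.leaderWeight b) : I.IsOptimalSolution ∅ {b} := by
  refine ⟨by simp, h.isPessimisticReaction, fun L' F' hL' hF' => ?_⟩
  rcases L'.eq_empty_or_nonempty with rfl | hne
  · exact (hF'.leaderObjective_eq h.isPessimisticReaction).le
  · rw [hF'.leaderObjective_eq_self hne]
    refine (hM.2.2 L' hL' hF'.isIndepSet).trans (hle.trans ?_)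
    simp [leaderObjective]

theorem IsMaxWeightLeaderIndepSet.isOptimalSolution {I : BISInstance K n} {M : Finset (Fin n)}
    (hM : I.IsMaxWeightLeaderIndepSet M) (hne : M.Nonempty)
    (hle : ∀ b, I.IsBestFollowerVertex b → I.leaderWeight b ≤ I.leaderObjective M) :
    I.IsOptimalSolution M ∅ := by
  refine ⟨hM.1, I.isPessimisticReaction_empty hne hM.2.1, fun L' F' hL' hF' => ?_⟩
  rw [Finset.union_empty]
  rcases L'.eq_empty_or_nonempty with rfl | hne'
  -- A reaction to `∅` is nonempty, so the follower owns a vertex and a best one exists.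
  · obtain ⟨b, hb⟩ := I.exists_isBestFollowerVertex
      (exists_notMem_of_isSuitableReaction_empty hF'.1.1)
    rw [hF'.leaderObjective_eq hb.isPessimisticReaction]
    simpa [leaderObjective] using hle b hb
  · rw [hF'.leaderObjective_eq_self hne']
    exact hM.2.2 L' hL' hF'.isIndepSet

theorem IsBestFollowerVertex.leaderWeight_eq {I : BISInstance K n} {b b' : Fin n}
    (h : I.IsBestFollowerVertex b) (h' : I.IsBestFollowerVertex b') :
    I.leaderWeight b = I.leaderWeight b' :=
  le_antisymm (h.min b' h'.notMem (h'.max b h.notMem)) (h'.min b h.notMem (h.max b' h'.notMem))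

theorem IsOptimalAction.eq_empty_or {I : BISInstance K n} {L : Finset (Fin n)}
    (hL : I.IsOptimalAction L) : L = ∅ ∨ I.IsMaxWeightLeaderIndepSet L := by
  obtain ⟨F, hsub, hF, hmax⟩ := hL
  rcases L.eq_empty_or_nonempty with rfl | hne
  · exact Or.inl rfl
  · refine Or.inr ⟨hsub, hF.isIndepSet, fun M' hM' hI' => ?_⟩
    rw [hF.leaderObjective_eq_self hne] at hmax
    rcases M'.eq_empty_or_nonempty with rfl | hne'
    · exact I.leaderObjective_mono (by simp)
    · simpa using hmax M' ∅ hM' (I.isPessimisticReaction_empty hne' hI')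

theorem IsMaxWeightLeaderIndepSet.isOptimalAction_or {I : BISInstance K n} {M : Finset (Fin n)}
    (hM : I.IsMaxWeightLeaderIndepSet M) (hne : M.Nonempty) :
    I.IsOptimalAction ∅ ∨ I.IsOptimalAction M := by
  by_cases h : ∃ b, I.IsBestFollowerVertex b ∧ I.leaderObjective M ≤ I.leaderWeight b
  · obtain ⟨b, hb, hle⟩ := h
    exact Or.inl ⟨_, hb.isOptimalSolution hM hle⟩
  · push Not at h
    exact Or.inr ⟨_, hM.isOptimalSolution hne fun b hb => (h b hb).le⟩

end BISInstance

/-! ### The program and the effect of its commands -/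

namespace AddRAM

section cells

variable {K : Type} (σ : State K)

@[simp] theorem State.nat_writeNat (a i x b j : ℕ) :
    (σ.writeNat a i x).nat b j = if b = a ∧ j = i then x else σ.nat b j := rfl

@[simp] theorem State.num_writeNat (a i x b j : ℕ) : (σ.writeNat a i x).num b j = σ.num b j := rfl

@[simp] theorem State.nat_writeNum (a i : ℕ) (x : K) (b j : ℕ) :
    (σ.writeNum a i x).nat b j = σ.nat b j := rfl

@[simp] theorem State.num_writeNum (a i : ℕ) (x : K) (b j : ℕ) :
    (σ.writeNum a i x).num b j = if b = a ∧ j = i then x else σ.num b j := rfl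

@[simp] theorem State.core_nat (b j : ℕ) : σ.core.nat b j = if b = 6 then 0 else σ.nat b j := rfl

@[simp] theorem State.core_num (b j : ℕ) : σ.core.num b j = σ.num b j := rfl

end cells

/-! ### The program

Besides the input, the program uses the natural arrays `3` (output), `4` (colours), `5` (distance
labels), `7` (label of the cut), `8` (best vertex of the follower), and the number arrays `2`
(value), `3` (excess) and `4` (flow). -/

abbrev adjacency : NatExp := .get 1 (.plus rowStart colIndex)
abbrev flowCell : NumExp := .get 4 (.plus rowStart colIndex)

/-- Colour `1` marks suppliers, which start with their weight as excess; demanders start with its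
negative. Follower vertices stay in the network with weight zero instead of being deleted. -/
def initExcess : Program :=
  .branch (.natLe (.lit 1) (.get 2 colIndex))
    (.branch (.natLe (.get 4 colIndex) (.lit 1))
      (.setNum 3 colIndex (.get 0 colIndex))
      (.setNum 3 colIndex (.minus .zero (.get 0 colIndex))))
    (.setNum 3 colIndex .zero)

def extendTest : Test :=
  .conj (.natLe (.lit 1) adjacency)
    (.conj (.natLe (.lit 1) (.get 4 rowIndex)) (.natLe (.get 4 colIndex) (.lit 0)))

/-- Subtraction from `3` exchanges the colours `1` and `2`. -/
def extendColour : Program :=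
  .seq (.setNat 4 colIndex (.minus (.lit 3) (.get 4 rowIndex))) initExcess

def freshTest : Test := .natLe (.get 4 colIndex) (.lit 0)

def freshColour : Program := .seq (.setNat 4 colIndex (.lit 1)) initExcess

def colouring : Program := whileFind₂ extendTest extendColour freshTest freshColour

def forwardTest : Test :=
  .conj (.conj (.natLe (.lit 1) adjacency) (.natLe (.get 4 rowIndex) (.lit 1)))
    (.conj (.numLt .zero (.get 3 rowIndex))
      (.natEq (.get 5 rowIndex) (.plus (.get 5 colIndex) (.lit 1))))

def pushForward : Program :=
  .seq (.setNum 4 (.plus rowStart colIndex) (.plus flowCell (.get 3 rowIndex)))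
    (.seq (.setNum 3 colIndex (.plus (.get 3 colIndex) (.get 3 rowIndex)))
      (.setNum 3 rowIndex .zero))

def backwardTest : Test :=
  .conj (.numLt .zero flowCell) (.conj (.numLt .zero (.get 3 colIndex))
    (.natEq (.get 5 colIndex) (.plus (.get 5 rowIndex) (.lit 1))))

def pushBackward : Program :=
  .branch (.numLe (.get 3 colIndex) flowCell)
    (.seq (.setNum 4 (.plus rowStart colIndex) (.minus flowCell (.get 3 colIndex)))
      (.seq (.setNum 3 rowIndex (.plus (.get 3 rowIndex) (.get 3 colIndex)))
        (.setNum 3 colIndex .zero)))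
    (.seq (.setNum 3 rowIndex (.plus (.get 3 rowIndex) flowCell))
      (.seq (.setNum 3 colIndex (.minus (.get 3 colIndex) flowCell))
        (.setNum 4 (.plus rowStart colIndex) .zero)))

/-- Relabeling at label `n` is still allowed, so stuck excess climbs to `n + 1` and the cut can
choose among the `n + 1` labels `0, …, n`. -/
def relabelTest : Test :=
  .conj (.numLt .zero (.get 3 colIndex)) (.natLe (.get 5 colIndex) dimension)

def relabelVertex : Program := .setNat 5 colIndex (.plus (.get 5 colIndex) (.lit 1))

def maximizeFlow : Program :=
  whileFind₃ forwardTest pushForward backwardTest pushBackward relabelTest relabelVertex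

def labelTest : Test := .natEq (.get 5 colIndex) (.get 7 (.lit 0))

def nextLabel : Program := .setNat 7 (.lit 0) (.plus (.get 7 (.lit 0)) (.lit 1))

def findUnusedLabel : Program := whileFind labelTest nextLabel

/-- Tests lack disjunction, so it is expressed by negated conjunctions; `betterTest` expresses its
implication likewise. -/
def selectTest : Test :=
  .conj (.conj (.natLe (.lit 1) (.get 2 colIndex)) (.natLe (.get 3 colIndex) (.lit 0)))
    (.neg (.conj
      (.neg (.conj (.natLe (.get 4 colIndex) (.lit 1))
        (.natLt (.get 7 (.lit 0)) (.get 5 colIndex))))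
      (.neg (.conj (.natLt (.lit 1) (.get 4 colIndex))
        (.natLt (.get 5 colIndex) (.get 7 (.lit 0)))))))

def selectVertex : Program :=
  .seq (.setNat 3 colIndex (.lit 1))
    (.setNum 2 (.lit 0) (.plus (.get 2 (.lit 0)) (.get 0 colIndex)))

def selectCut : Program := whileFind selectTest selectVertex

def selectedTest : Test := .natLe (.lit 1) (.get 3 colIndex)

def leaderTest : Test := .natLe (.lit 1) (.get 2 colIndex)

/-- The set found may be empty, but the action `∅` would force a reaction of the follower. Any
vertex of the leader is then as good as the empty set in weight and makes the action nonempty. -/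
def ensureNonempty : Program := firstOf selectedTest .skip (firstOf leaderTest selectVertex .skip)

def followerTest : Test := .natLe (.get 2 colIndex) (.lit 0)

def setBest : Program := .setNat 8 (.lit 0) colIndex

abbrev bestVertex : NatExp := .get 8 (.lit 0)

def betterTest : Test :=
  .conj followerTest (.neg (.conj
    (.numLe (.get 1 colIndex) (.get 1 bestVertex))
    (.neg (.conj (.numLe (.get 1 bestVertex) (.get 1 colIndex))
      (.numLt (.get 0 colIndex) (.get 0 bestVertex))))))

def improveBest : Program := whileFind betterTest setBest

def unselect : Program := .setNat 3 colIndex (.lit 0)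

def clearSelection : Program := whileFind selectedTest unselect

def selectBest : Program :=
  .seq (.setNat 3 bestVertex (.lit 1)) (.setNum 2 (.lit 0) (.get 0 bestVertex))

def compareWithBest : Program :=
  .branch (.numLe (.get 2 (.lit 0)) (.get 0 bestVertex)) (.seq clearSelection selectBest) .skip

def considerFollower : Program :=
  firstOf followerTest (.seq setBest (.seq improveBest compareWithBest)) .skip

/-- The program for Bilevel Independent Set on bipartite graphs. -/
def bilevelProgram : Program :=
  .seq colouring (.seq maximizeFlow (.seq findUnusedLabel (.seq selectCut
    (.seq ensureNonempty considerFollower))))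

/-! ### Meaning of the tests and actions -/

section meaning

variable {K : Type} [Field K] [LinearOrder K]

/-- Give the vertex `v` the colour `x` and its initial excess. -/
def colourEffect (σ : State K) (v x : ℕ) : State K :=
  (σ.writeNat 4 v x).writeNum 3 v
    (if 1 ≤ σ.nat 2 v then (if x ≤ 1 then σ.num 0 v else 0 - σ.num 0 v) else 0)

theorem extendTest_expresses (n : ℕ) : extendTest.Expresses n fun (σ : State K) u v =>
    1 ≤ σ.nat 1 (u * n + v) ∧ 1 ≤ σ.nat 4 u ∧ σ.nat 4 v = 0 := by
  rintro σ u v - - ⟨h0, h1, h2⟩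
  simp [extendTest, Test.Holds, NatExp.eval, h0, h1, h2]

theorem freshTest_expresses (n : ℕ) : freshTest.Expresses n fun (σ : State K) _ v =>
    σ.nat 4 v = 0 := by
  rintro σ u v - - ⟨h0, h1, h2⟩
  simp [freshTest, Test.Holds, NatExp.eval, h1]

theorem extendColour_performs (n : ℕ) : extendColour.Performs n fun (σ : State K) u v =>
    colourEffect σ v (3 - σ.nat 4 u) := by
  refine ⟨by simp [extendColour, initExcess, Program.LoopFree], ?_⟩
  rintro σ u v - - ⟨h0, h1, h2⟩
  simp only [extendColour, initExcess, Program.run, NatExp.eval, Test.Holds, NumExp.eval, h0, h1]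
  split_ifs <;> simp_all [colourEffect, State.core_writeNat, State.core_writeNum]
  rw [if_neg (by omega)]

theorem freshColour_performs (n : ℕ) : freshColour.Performs n fun (σ : State K) _ v =>
    colourEffect σ v 1 := by
  refine ⟨by simp [freshColour, initExcess, Program.LoopFree], ?_⟩
  rintro σ u v - - ⟨h0, h1, h2⟩
  simp only [freshColour, initExcess, Program.run, NatExp.eval, Test.Holds, NumExp.eval, h1]
  split_ifs <;> simp_all [colourEffect, State.core_writeNat, State.core_writeNum]

theorem forwardTest_expresses (n : ℕ) : forwardTest.Expresses n fun (σ : State K) u v =>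
    (1 ≤ σ.nat 1 (u * n + v) ∧ σ.nat 4 u ≤ 1) ∧ 0 < σ.num 3 u ∧ σ.nat 5 u = σ.nat 5 v + 1 := by
  rintro σ u v - - ⟨h0, h1, h2⟩
  simp [forwardTest, Test.Holds, NatExp.eval, NumExp.eval, h0, h1, h2]
  omega

def forwardEffect (n : ℕ) (σ : State K) (u v : ℕ) : State K :=
  ((σ.writeNum 4 (u * n + v) (σ.num 4 (u * n + v) + σ.num 3 u)).writeNum 3 v
    (σ.num 3 v + σ.num 3 u)).writeNum 3 u 0

theorem pushForward_performs (n : ℕ) :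
    pushForward.Performs n (forwardEffect (K := K) n) := by
  refine ⟨by simp [pushForward, Program.LoopFree], ?_⟩
  rintro σ u v - - ⟨h0, h1, h2⟩
  simp [pushForward, Program.run, NatExp.eval, NumExp.eval, h0, h1, h2, forwardEffect,
    State.core_writeNum]

theorem backwardTest_expresses (n : ℕ) : backwardTest.Expresses n fun (σ : State K) u v =>
    0 < σ.num 4 (u * n + v) ∧ 0 < σ.num 3 v ∧ σ.nat 5 v = σ.nat 5 u + 1 := by
  rintro σ u v - - ⟨h0, h1, h2⟩
  simp [backwardTest, Test.Holds, NatExp.eval, NumExp.eval, h0, h1, h2]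
  omega

def backwardEffect (n : ℕ) (σ : State K) (u v : ℕ) : State K :=
  if σ.num 3 v ≤ σ.num 4 (u * n + v) then
    ((σ.writeNum 4 (u * n + v) (σ.num 4 (u * n + v) - σ.num 3 v)).writeNum 3 u
      (σ.num 3 u + σ.num 3 v)).writeNum 3 v 0
  else
    ((σ.writeNum 3 u (σ.num 3 u + σ.num 4 (u * n + v))).writeNum 3 v
      -- The program writes the excess at `u` before it reads the one at `v`, so the formula must
      -- allow for `v = u`.
      ((if v = u then σ.num 3 u + σ.num 4 (u * n + v) else σ.num 3 v) -
        σ.num 4 (u * n + v))).writeNum 4 (u * n + v) 0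

theorem pushBackward_performs (n : ℕ) :
    pushBackward.Performs n (backwardEffect (K := K) n) := by
  refine ⟨by simp [pushBackward, Program.LoopFree], ?_⟩
  rintro σ u v - - ⟨h0, h1, h2⟩
  simp only [pushBackward, Program.run, backwardEffect, Test.Holds, NatExp.eval, NumExp.eval]
  by_cases h : σ.num 3 v ≤ σ.num 4 (u * n + v) <;>
    simp [h0, h1, h2, State.core_writeNum, h]

theorem relabelTest_expresses (n : ℕ) : relabelTest.Expresses n fun (σ : State K) _ v =>
    0 < σ.num 3 v ∧ σ.nat 5 v ≤ σ.nat 0 0 := by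
  rintro σ u v - - ⟨h0, h1, h2⟩
  simp [relabelTest, Test.Holds, NatExp.eval, NumExp.eval, h1]

theorem relabelVertex_performs (n : ℕ) : relabelVertex.Performs n fun (σ : State K) _ v =>
    σ.writeNat 5 v (σ.nat 5 v + 1) := by
  refine ⟨trivial, ?_⟩
  rintro σ u v - - ⟨h0, h1, h2⟩
  simp [relabelVertex, Program.run, NatExp.eval, h1, State.core_writeNat]

theorem labelTest_expresses (n : ℕ) : labelTest.Expresses n fun (σ : State K) _ v =>
    σ.nat 5 v = σ.nat 7 0 := by
  rintro σ u v - - ⟨h0, h1, h2⟩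
  simp [labelTest, Test.Holds, NatExp.eval, h1, ← le_antisymm_iff]

theorem nextLabel_performs (n : ℕ) : nextLabel.Performs n fun (σ : State K) _ _ =>
    σ.writeNat 7 0 (σ.nat 7 0 + 1) := by
  refine ⟨trivial, ?_⟩
  rintro σ u v - - ⟨h0, h1, h2⟩
  simp [nextLabel, Program.run, NatExp.eval, State.core_writeNat]

theorem selectTest_expresses (n : ℕ) : selectTest.Expresses n fun (σ : State K) _ v =>
    (1 ≤ σ.nat 2 v ∧ σ.nat 3 v = 0) ∧
      (σ.nat 4 v ≤ 1 ∧ σ.nat 7 0 < σ.nat 5 v ∨ 1 < σ.nat 4 v ∧ σ.nat 5 v < σ.nat 7 0) := by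
  rintro σ u v - - ⟨h0, h1, h2⟩
  simp [selectTest, Test.Holds, NatExp.eval, h1]
  omega

def selectEffect (σ : State K) (v : ℕ) : State K :=
  (σ.writeNat 3 v 1).writeNum 2 0 (σ.num 2 0 + σ.num 0 v)

theorem selectVertex_performs (n : ℕ) : selectVertex.Performs n fun (σ : State K) _ v =>
    selectEffect σ v := by
  refine ⟨by simp [selectVertex, Program.LoopFree], ?_⟩
  rintro σ u v - - ⟨h0, h1, h2⟩
  simp [selectVertex, Program.run, NatExp.eval, NumExp.eval, h1, State.core_writeNat,
    State.core_writeNum, selectEffect]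

theorem selectedTest_expresses (n : ℕ) : selectedTest.Expresses n fun (σ : State K) _ v =>
    1 ≤ σ.nat 3 v := by
  rintro σ u v - - ⟨h0, h1, h2⟩
  simp [selectedTest, Test.Holds, NatExp.eval, h1]

theorem leaderTest_expresses (n : ℕ) : leaderTest.Expresses n fun (σ : State K) _ v =>
    1 ≤ σ.nat 2 v := by
  rintro σ u v - - ⟨h0, h1, h2⟩
  simp [leaderTest, Test.Holds, NatExp.eval, h1]

theorem followerTest_expresses (n : ℕ) : followerTest.Expresses n fun (σ : State K) _ v =>
    ¬ 1 ≤ σ.nat 2 v := by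
  rintro σ u v - - ⟨h0, h1, h2⟩
  simp [followerTest, Test.Holds, NatExp.eval, h1]

theorem setBest_performs (n : ℕ) : setBest.Performs n fun (σ : State K) _ v =>
    σ.writeNat 8 0 v := by
  refine ⟨trivial, ?_⟩
  rintro σ u v - - ⟨h0, h1, h2⟩
  simp [setBest, Program.run, NatExp.eval, h1, State.core_writeNat]

theorem betterTest_expresses (n : ℕ) : betterTest.Expresses n fun (σ : State K) _ v =>
    ¬ 1 ≤ σ.nat 2 v ∧ (σ.num 1 v ≤ σ.num 1 (σ.nat 8 0) →
      σ.num 1 (σ.nat 8 0) ≤ σ.num 1 v ∧ σ.num 0 v < σ.num 0 (σ.nat 8 0)) := by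
  rintro σ u v - - ⟨h0, h1, h2⟩
  simp [betterTest, followerTest, Test.Holds, NatExp.eval, NumExp.eval, h1]

theorem unselect_performs (n : ℕ) : unselect.Performs n fun (σ : State K) _ v =>
    σ.writeNat 3 v 0 := by
  refine ⟨trivial, ?_⟩
  rintro σ u v - - ⟨h0, h1, h2⟩
  simp [unselect, Program.run, NatExp.eval, h1, State.core_writeNat]

theorem selectBest_run (σ : State K) : (selectBest.run σ).core =
    (σ.core.writeNat 3 (σ.core.nat 8 0) 1).writeNum 2 0 (σ.core.num 0 (σ.core.nat 8 0)) := by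
  simp [selectBest, Program.run, NatExp.eval, NumExp.eval, State.core_writeNat,
    State.core_writeNum]

end meaning

end AddRAM

/-! ### Correctness of colouring and flow -/

namespace BISInstance

open AddRAM

set_option linter.unusedSectionVars false

variable {K : Type} [Field K] [LinearOrder K] [IsStrictOrderedRing K] {n : ℕ}
  (I : BISInstance K n)

/-! ### The input in memory -/

/-- The memory contains the instance in the input cells. -/
structure IsInput (σ : State K) : Prop where
  size : σ.nat 0 0 = n
  adj : ∀ u v : Fin n, 1 ≤ σ.nat 1 (u * n + v) ↔ I.graph.Adj u v
  leader : ∀ v : Fin n, 1 ≤ σ.nat 2 v ↔ v ∈ I.leader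
  leaderWeight : ∀ v : Fin n, σ.num 0 v = I.leaderWeight v
  followerWeight : ∀ v : Fin n, σ.num 1 v = I.followerWeight v

variable {I}

theorem IsInput.writeNat {σ : State K} (h : I.IsInput σ) {a : ℕ} (ha : 2 < a) (i x : ℕ) :
    I.IsInput (σ.writeNat a i x) := by
  have key : ∀ b j, b ≤ 2 → (σ.writeNat a i x).nat b j = σ.nat b j := by
    intro b j hb
    have : b ≠ a := by omega
    simp [this]
  refine ⟨?_, fun u v => ?_, fun v => ?_, h.leaderWeight, h.followerWeight⟩
  · rw [key _ _ (by omega), h.size]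
  · rw [key _ _ (by omega), h.adj]
  · rw [key _ _ (by omega), h.leader]

theorem IsInput.writeNum {σ : State K} (h : I.IsInput σ) {a : ℕ} (ha : 1 < a) (i : ℕ) (x : K) :
    I.IsInput (σ.writeNum a i x) := by
  have key : ∀ b j, b ≤ 1 → (σ.writeNum a i x).num b j = σ.num b j := by
    intro b j hb
    have : b ≠ a := by omega
    simp [this]
  refine ⟨h.size, h.adj, h.leader, fun v => ?_, fun v => ?_⟩
  · rw [key _ _ (by omega), h.leaderWeight]
  · rw [key _ _ (by omega), h.followerWeight]

theorem pair_index_inj {a b u v : Fin n} :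
    (a : ℕ) * n + b = u * n + v ↔ a = u ∧ b = v := by
  refine ⟨fun h => ?_, fun h => by rw [h.1, h.2]⟩
  have e1 : b = v := by
    have := congrArg (· % n) h
    exact Fin.ext (by
      simpa [Nat.mul_add_mod_of_lt, Nat.mod_eq_of_lt b.2, Nat.mod_eq_of_lt v.2] using this)
  subst e1
  exact ⟨Fin.ext (Nat.eq_of_mul_eq_mul_right b.pos (Nat.add_right_cancel h)), rfl⟩

theorem card_filter_lt_of_imp {p q : Fin n → Prop} [DecidablePred p] [DecidablePred q]
    (h : ∀ v, q v → p v) {v : Fin n} (hp : p v) (hq : ¬ q v) :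
    (Finset.univ.filter q).card < (Finset.univ.filter p).card := by
  refine Finset.card_lt_card ⟨fun x hx => ?_, fun hs => hq ?_⟩
  · simp only [Finset.mem_filter, Finset.mem_univ, true_and] at hx ⊢
    exact h x hx
  · simpa using hs (by simpa using hp : v ∈ Finset.univ.filter p)

theorem card_filter_le_size (p : Fin n → Prop) [DecidablePred p] :
    (Finset.univ.filter p).card ≤ n := by
  simpa using Finset.card_le_univ (Finset.univ.filter p)

/-! ### Colouring -/

variable (I) in
/-- The weight of the leader, with the vertices of the follower counted as worthless. -/
def effectiveWeight (v : Fin n) : K := if v ∈ I.leader then I.leaderWeight v else 0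

variable (I) in
/-- The colours found so far agree with the proper colouring `c`. -/
structure ColouringInv (c : Fin n → Bool) (σ : State K) : Prop where
  input : I.IsInput σ
  clean : ∀ i, σ.nat 3 i = 0 ∧ σ.nat 5 i = 0 ∧ σ.nat 7 i = 0 ∧ σ.num 2 i = 0 ∧ σ.num 4 i = 0
  proper : ∀ a b, I.graph.Adj a b → c a ≠ c b
  colour : ∀ v : Fin n, σ.nat 4 v = 0 ∨ (σ.nat 4 v = (if c v = true then 1 else 2) ∧
    σ.num 3 v = if c v = true then I.effectiveWeight v else -I.effectiveWeight v)

theorem ColouringInv.step {c : Fin n → Bool} {σ : State K} (h : I.ColouringInv c σ) (v : Fin n)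
    {x : ℕ} (hx : x = if c v = true then 1 else 2) : I.ColouringInv c (colourEffect σ v x) where
  input := (h.input.writeNat (by omega) _ _).writeNum (by omega) _ _
  clean i := by simpa [colourEffect] using h.clean i
  proper := h.proper
  colour u := by
    by_cases huv : u = v
    · subst huv
      refine Or.inr ⟨by simp [colourEffect, hx], ?_⟩
      have hl := h.input.leader u
      have hw := h.input.leaderWeight u
      by_cases hu : u ∈ I.leader <;> by_cases hc : c u = true <;>
        simp [colourEffect, hl, hw, hu, hx, hc, effectiveWeight]
    · have : (u : ℕ) ≠ v := fun h => huv (Fin.ext h)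
      simpa [colourEffect, this] using h.colour u

theorem colourEffect_potential (σ : State K) (v : Fin n) {x : ℕ} (hx : x ≠ 0)
    (hv : σ.nat 4 v = 0) :
    (Finset.univ.filter fun u : Fin n => (colourEffect σ v x).nat 4 u = 0).card <
      (Finset.univ.filter fun u : Fin n => σ.nat 4 u = 0).card := by
  refine card_filter_lt_of_imp (v := v) (fun u hu => ?_) hv (by simp [colourEffect, hx])
  by_cases h : (u : ℕ) = v
  · simp [colourEffect, h, hx] at hu
  · simpa [colourEffect, h] using hu

theorem colouring_reaches (hn : 0 < n) (σ : State K) (hσ : ∃ c, I.ColouringInv c σ.core) :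
    Reaches colouring σ (whileTime₂ extendTest extendColour freshTest freshColour n n)
      fun τ => (∃ c, I.ColouringInv c τ.core) ∧ ∀ v : Fin n, τ.core.nat 4 v ≠ 0 := by
  refine Reaches.mono (whileFind₂_reaches hn (extendTest_expresses n) (extendColour_performs n)
    (freshTest_expresses n) (freshColour_performs n) (Inv := fun σ => ∃ c, I.ColouringInv c σ)
    (Φ := fun σ => (Finset.univ.filter fun u : Fin n => σ.nat 4 u = 0).card)
    (fun σ ⟨c, h⟩ => h.input.size) ?_ ?_ σ hσ (card_filter_le_size _)) le_rfl ?_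
  · rintro σ u v hu hv ⟨c, h⟩ ⟨hadj, hcu, hcv⟩
    have hne := h.proper _ _ ((h.input.adj ⟨u, hu⟩ ⟨v, hv⟩).1 hadj)
    have hx : 3 - σ.nat 4 u = if c ⟨v, hv⟩ = true then 1 else 2 := by
      rcases h.colour ⟨u, hu⟩ with h0 | ⟨h1, -⟩
      · simp only at h0; omega
      · simp only at h1
        rw [h1]
        cases h2 : c ⟨u, hu⟩ <;> cases h3 : c ⟨v, hv⟩ <;> simp_all
    exact ⟨⟨c, h.step ⟨v, hv⟩ hx⟩,
      colourEffect_potential σ ⟨v, hv⟩ (by rw [hx]; split_ifs <;> omega) hcv⟩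
  · rintro σ u v hu hv ⟨c, h⟩ hclosed hcv
    refine ⟨?_, colourEffect_potential σ ⟨v, hv⟩ (by omega) hcv⟩
    -- A fresh vertex always receives colour `1`. If `c` disagrees, it is flipped on all uncoloured
    -- vertices; as no colour can be extended, no edge joins them to coloured ones, and the flipped
    -- colouring is still proper.
    rcases hc : c ⟨v, hv⟩ with _ | _
    · have hcut : ∀ a b : Fin n, I.graph.Adj a b → (σ.nat 4 a = 0 ↔ σ.nat 4 b = 0) := by
        intro a b hab
        have h1 := hclosed a b a.2 b.2
        have h2 := hclosed b a b.2 a.2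
        rw [h.input.adj] at h1 h2
        have h3 : ¬ (1 ≤ σ.nat 4 a ∧ σ.nat 4 b = 0) := fun h0 => h1 ⟨hab, h0⟩
        have h4 : ¬ (1 ≤ σ.nat 4 b ∧ σ.nat 4 a = 0) := fun h0 => h2 ⟨hab.symm, h0⟩
        omega
      have h' : I.ColouringInv (fun x => if σ.nat 4 x = 0 then !c x else c x) σ := by
        refine ⟨h.input, h.clean, fun a b hab => ?_, fun x => ?_⟩
        · have h1 := h.proper a b hab
          have h2 := hcut a b hab
          by_cases h3 : σ.nat 4 b = 0
          · simpa [h2.2 h3, h3] using h1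
          · have h4 : σ.nat 4 a ≠ 0 := fun h0 => h3 (h2.1 h0)
            simpa [h4, h3] using h1
        · rcases h.colour x with h1 | h1
          · exact Or.inl h1
          · by_cases h2 : σ.nat 4 x = 0
            · exact Or.inl h2
            · exact Or.inr (by simpa [h2] using h1)
      have hcv' : σ.nat 4 ((⟨v, hv⟩ : Fin n) : ℕ) = 0 := hcv
      exact ⟨_, h'.step ⟨v, hv⟩ (by rw [if_pos hcv', hc]; simp)⟩
    · exact ⟨c, h.step ⟨v, hv⟩ (by simp [hc])⟩
  · rintro τ ⟨h1, -, h2⟩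
    exact ⟨h1, fun v => h2 v v v.2 v.2⟩

/-! ### Maximizing the flow -/

/-- The arcs of the flow network. -/
def arc (I : BISInstance K n) (c : Fin n → Bool) (a b : Fin n) : Prop :=
  I.graph.Adj a b ∧ c a = true

def flowOf (n : ℕ) (σ : State K) (a b : Fin n) : K := σ.num 4 (a * n + b)

def excessOf (n : ℕ) (σ : State K) (v : Fin n) : K := σ.num 3 v

def labelOf (n : ℕ) (σ : State K) (v : Fin n) : ℕ := σ.nat 5 v

variable (I) in
structure FlowInv (c : Fin n → Bool) (σ : State K) : Prop where
  input : I.IsInput σ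
  clean : ∀ i, σ.nat 3 i = 0 ∧ σ.nat 7 i = 0 ∧ σ.num 2 i = 0
  proper : ∀ a b, I.graph.Adj a b → c a ≠ c b
  colour : ∀ v : Fin n, σ.nat 4 v = if c v = true then 1 else 2
  preflow : IsPreflow (I.arc c) c I.effectiveWeight (n + 1) (flowOf n σ) (excessOf n σ)
    (labelOf n σ)

theorem arc_colours {c : Fin n → Bool} (hc : ∀ a b, I.graph.Adj a b → c a ≠ c b) (a b : Fin n)
    (h : I.arc c a b) : c a = true ∧ c b = false := by
  have h1 := hc a b h.1
  have h2 := h.2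
  rw [h2] at h1
  exact ⟨h2, by cases h3 : c b <;> simp_all⟩

theorem arc_ne {c : Fin n → Bool} {a b : Fin n} (h : I.arc c a b) : a ≠ b := h.1.ne

theorem effectiveWeight_nonneg (v : Fin n) : 0 ≤ I.effectiveWeight v := by
  unfold effectiveWeight
  split_ifs
  exacts [I.leaderWeight_nonneg v, le_rfl]

/-- The zero flow with zero labels is a preflow for the initial excesses. -/
theorem ColouringInv.flowInv {c : Fin n → Bool} {σ : State K} (h : I.ColouringInv c σ)
    (hc : ∀ v : Fin n, σ.nat 4 v ≠ 0) : I.FlowInv c σ := by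
  have hcol : ∀ v : Fin n, _ := fun v => (h.colour v).resolve_left (hc v)
  have hf : flowOf n σ = fun _ _ => 0 := by
    funext a b; exact (h.clean _).2.2.2.2
  have hd : labelOf n σ = fun _ => 0 := by
    funext a; exact (h.clean _).2.1
  refine ⟨h.input, fun i => ⟨(h.clean i).1, (h.clean i).2.2.1, (h.clean i).2.2.2.1⟩, h.proper,
    fun v => (hcol v).1, ?_⟩
  rw [hf, hd]
  refine ⟨by simp, by simp, fun v => ?_, fun a ha => ?_, by simp, by simp, by simp, by simp⟩
  · have := (hcol v).2
    simp only [excessOf, this]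
    split_ifs <;> simp
  · have := (hcol a).2
    rw [excessOf, this, if_pos ha]
    exact effectiveWeight_nonneg a

theorem flowOf_forwardEffect (σ : State K) (u v : Fin n) :
    flowOf n (forwardEffect n σ u v) = pushFlow (flowOf n σ) u v (excessOf n σ u) := by
  funext a b
  by_cases h : a = u ∧ b = v
  · obtain ⟨rfl, rfl⟩ := h
    simp [flowOf, forwardEffect, pushFlow, excessOf]
  · simp [flowOf, forwardEffect, pushFlow, pair_index_inj, h]

theorem excessOf_forwardEffect (σ : State K) {u v : Fin n} (huv : u ≠ v) :
    excessOf n (forwardEffect n σ u v) = pushExcess (excessOf n σ) u v (excessOf n σ u) := by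
  funext a
  have huv' : (u : ℕ) ≠ v := fun h => huv (Fin.ext h)
  by_cases hu : a = u
  · subst hu
    simp [excessOf, forwardEffect, pushExcess, huv]
  · have hu' : (a : ℕ) ≠ u := fun h => hu (Fin.ext h)
    by_cases hv : a = v
    · subst hv
      simp [excessOf, forwardEffect, pushExcess, hu, hu']
    · have hv' : (a : ℕ) ≠ v := fun h => hv (Fin.ext h)
      simp [excessOf, forwardEffect, pushExcess, hu, hu', hv, hv']

/-- The amount pushed back along the arc from `u` to `v`. -/
def backwardAmount (n : ℕ) (σ : State K) (u v : Fin n) : K :=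
  if excessOf n σ v ≤ flowOf n σ u v then -excessOf n σ v else -flowOf n σ u v

theorem flowOf_backwardEffect (σ : State K) (u v : Fin n) :
    flowOf n (backwardEffect n σ u v) = pushFlow (flowOf n σ) u v (backwardAmount n σ u v) := by
  funext a b
  by_cases h : a = u ∧ b = v
  · obtain ⟨rfl, rfl⟩ := h
    unfold backwardAmount flowOf backwardEffect pushFlow excessOf
    split_ifs <;> simp_all [sub_eq_add_neg]
  · unfold backwardEffect
    split_ifs <;> simp [flowOf, pushFlow, pair_index_inj, h]

theorem excessOf_backwardEffect (σ : State K) {u v : Fin n} (huv : u ≠ v) :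
    excessOf n (backwardEffect n σ u v) =
      pushExcess (excessOf n σ) u v (backwardAmount n σ u v) := by
  funext a
  have huv' : (u : ℕ) ≠ v := fun h => huv (Fin.ext h)
  unfold backwardEffect backwardAmount
  by_cases hu : a = u
  · subst hu
    by_cases hc : σ.num 3 v ≤ σ.num 4 (a * n + v) <;>
      simp [excessOf, flowOf, pushExcess, huv, huv', hc]
  · have hu' : (a : ℕ) ≠ u := fun h => hu (Fin.ext h)
    by_cases hv : a = v
    · subst hv
      by_cases hc : σ.num 3 a ≤ σ.num 4 (u * n + a) <;>
        simp [excessOf, flowOf, pushExcess, hu, hu', hc, sub_eq_add_neg]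
    · have hv' : (a : ℕ) ≠ v := fun h => hv (Fin.ext h)
      by_cases hc : σ.num 3 v ≤ σ.num 4 (u * n + v) <;>
        simp [excessOf, pushExcess, hu, hu', hv, hv', hc]

theorem FlowInv.of_forward {c : Fin n → Bool} {σ : State K} (h : I.FlowInv c σ) {u v : Fin n}
    (hR : (1 ≤ σ.nat 1 (u * n + v) ∧ σ.nat 4 u ≤ 1) ∧ 0 < σ.num 3 u ∧
      σ.nat 5 u = σ.nat 5 v + 1) :
    I.FlowInv c (forwardEffect n σ u v) ∧
      preflowPotential (n + 1) (flowOf n (forwardEffect n σ u v))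
        (excessOf n (forwardEffect n σ u v)) (labelOf n (forwardEffect n σ u v)) <
      preflowPotential (n + 1) (flowOf n σ) (excessOf n σ) (labelOf n σ) := by
  obtain ⟨⟨hadj, hcol⟩, hpos, hlab⟩ := hR
  have hcu : c u = true := by
    by_contra h0
    rw [h.colour u, if_neg h0] at hcol
    omega
  have hE : I.arc c u v := ⟨(h.input.adj u v).1 hadj, hcu⟩
  have hne := arc_ne hE
  have hd : labelOf n (forwardEffect n σ u v) = labelOf n σ := rfl
  have hlab' : labelOf n σ u = labelOf n σ v + 1 := hlab
  rw [flowOf_forwardEffect, excessOf_forwardEffect σ hne, hd]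
  refine ⟨⟨((h.input.writeNum (by omega) _ _).writeNum (by omega) _ _).writeNum (by omega) _ _,
    fun i => by simpa [forwardEffect] using h.clean i, h.proper, h.colour, ?_⟩,
    preflowPotential_push_forward hne hpos hlab⟩
  rw [flowOf_forwardEffect, excessOf_forwardEffect σ hne, hd]
  have h1 := h.preflow.nonneg u v
  exact h.preflow.push hcu (arc_colours h.proper u v hE).2 hE
    (add_nonneg h1 hpos.le) (by simp) (fun h0 => absurd hpos h0.asymm) (fun _ => by omega)

theorem FlowInv.of_backward {c : Fin n → Bool} {σ : State K} (h : I.FlowInv c σ) {u v : Fin n}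
    (hR : 0 < σ.num 4 (u * n + v) ∧ 0 < σ.num 3 v ∧ σ.nat 5 v = σ.nat 5 u + 1) :
    I.FlowInv c (backwardEffect n σ u v) ∧
      preflowPotential (n + 1) (flowOf n (backwardEffect n σ u v))
        (excessOf n (backwardEffect n σ u v)) (labelOf n (backwardEffect n σ u v)) <
      preflowPotential (n + 1) (flowOf n σ) (excessOf n σ) (labelOf n σ) := by
  obtain ⟨hf, hpos, hlab⟩ := hR
  have hf' : 0 < flowOf n σ u v := hf
  have hpos' : 0 < excessOf n σ v := hpos
  have hE : I.arc c u v := h.preflow.supp u v hf'.ne'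
  have hne := arc_ne hE
  have hd : labelOf n (backwardEffect n σ u v) = labelOf n σ := by
    unfold backwardEffect; split_ifs <;> rfl
  have hlab' : labelOf n σ v = labelOf n σ u + 1 := hlab
  have hinput : I.IsInput (backwardEffect n σ u v) := by
    unfold backwardEffect
    split_ifs <;>
      exact ((h.input.writeNum (by omega) _ _).writeNum (by omega) _ _).writeNum (by omega) _ _
  have hclean : ∀ i, (backwardEffect n σ u v).nat 3 i = 0 ∧
      (backwardEffect n σ u v).nat 7 i = 0 ∧ (backwardEffect n σ u v).num 2 i = 0 := by
    intro i
    unfold backwardEffect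
    split_ifs <;> simpa using h.clean i
  have hcolour : ∀ w : Fin n, (backwardEffect n σ u v).nat 4 w = if c w = true then 1 else 2 := by
    have hnat : (backwardEffect n σ u v).nat = σ.nat := by
      unfold backwardEffect; split_ifs <;> rfl
    rw [hnat]
    exact h.colour
  obtain ⟨hcu, hcv⟩ := arc_colours h.proper u v hE
  have h1 := h.preflow.source_nonneg u hcu
  -- The amount is minus the smaller of excess and flow, so neither becomes negative.
  have h2 : backwardAmount n σ u v < 0 ∧ 0 ≤ flowOf n σ u v + backwardAmount n σ u v ∧
      0 ≤ excessOf n σ v + backwardAmount n σ u v := by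
    unfold backwardAmount
    split_ifs with h3
    · exact ⟨by linarith, by linarith, by linarith⟩
    · exact ⟨by linarith, by linarith, by linarith⟩
  refine ⟨⟨hinput, hclean, h.proper, hcolour, ?_⟩, ?_⟩
  · rw [flowOf_backwardEffect, excessOf_backwardEffect σ hne, hd]
    exact h.preflow.push hcu hcv hE h2.2.1 (by linarith [h2.1]) (fun _ => h2.2.2)
      (fun _ => by omega)
  · rw [flowOf_backwardEffect, excessOf_backwardEffect σ hne, hd]
    unfold backwardAmount
    split_ifs with h3
    · exact preflowPotential_push_backward hne hpos' h3 hlab'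
    · exact preflowPotential_push_cancel hne hf' (not_le.1 h3) hlab' (h.preflow.label_le u)

theorem labelOf_relabel (σ : State K) (v : Fin n) : labelOf n (σ.writeNat 5 v (σ.nat 5 v + 1)) =
    Function.update (labelOf n σ) v (labelOf n σ v + 1) := by
  funext a
  by_cases h : a = v
  · subst h; simp [labelOf]
  · have h' : (a : ℕ) ≠ v := fun h0 => h (Fin.ext h0)
    simp [labelOf, h, h']

theorem FlowInv.of_relabel {c : Fin n → Bool} {σ : State K} (h : I.FlowInv c σ)
    (hfwd : ∀ u v, u < n → v < n → ¬ ((1 ≤ σ.nat 1 (u * n + v) ∧ σ.nat 4 u ≤ 1) ∧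
      0 < σ.num 3 u ∧ σ.nat 5 u = σ.nat 5 v + 1))
    (hbwd : ∀ u v, u < n → v < n → ¬ (0 < σ.num 4 (u * n + v) ∧ 0 < σ.num 3 v ∧
      σ.nat 5 v = σ.nat 5 u + 1)) {v : Fin n}
    (hR : 0 < σ.num 3 v ∧ σ.nat 5 v ≤ σ.nat 0 0) :
    I.FlowInv c (σ.writeNat 5 v (σ.nat 5 v + 1)) ∧
      preflowPotential (n + 1) (flowOf n (σ.writeNat 5 v (σ.nat 5 v + 1)))
        (excessOf n (σ.writeNat 5 v (σ.nat 5 v + 1)))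
        (labelOf n (σ.writeNat 5 v (σ.nat 5 v + 1))) <
      preflowPotential (n + 1) (flowOf n σ) (excessOf n σ) (labelOf n σ) := by
  obtain ⟨hpos, hle⟩ := hR
  have hlt : labelOf n σ v < n + 1 := by
    rw [h.input.size] at hle
    exact Nat.lt_succ_of_le hle
  have hf : flowOf n (σ.writeNat 5 v (σ.nat 5 v + 1)) = flowOf n σ := rfl
  have hg : excessOf n (σ.writeNat 5 v (σ.nat 5 v + 1)) = excessOf n σ := rfl
  refine ⟨⟨h.input.writeNat (by omega) _ _, fun i => by simpa using h.clean i, h.proper,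
    fun w => by simpa using h.colour w, ?_⟩, ?_⟩
  · rw [hf, hg, labelOf_relabel]
    refine h.preflow.relabel (arc_colours h.proper) hpos hlt (fun b hb hd => ?_)
      (fun a ha hd => ?_)
    · exact hfwd v b v.2 b.2 ⟨⟨(h.input.adj v b).2 hb.1, by rw [h.colour v, if_pos hb.2]⟩, hpos, hd⟩
    · exact hbwd a v a.2 v.2 ⟨ha, hpos, hd⟩
  · rw [hf, hg, labelOf_relabel]
    exact preflowPotential_relabel hlt fun w hw =>
      arc_ne (h.preflow.supp w w hw.ne') rfl

/-- The number of pushes and relabelings. -/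
def flowSteps (n : ℕ) : ℕ :=
  (n + 1 + 1) * (n * n * (2 * (n + 1) + 1)) + 3 * (n * (n + 1))

theorem maximizeFlow_reaches (hn : 0 < n) (σ : State K) (hσ : ∃ c, I.FlowInv c σ.core) :
    Reaches maximizeFlow σ (whileTime₃ forwardTest pushForward backwardTest pushBackward
        relabelTest relabelVertex n (flowSteps n))
      fun τ => ∃ c, I.FlowInv c τ.core ∧
        ∀ v : Fin n, 0 < excessOf n τ.core v → n + 1 ≤ labelOf n τ.core v := by
  obtain ⟨c, hc⟩ := hσ
  refine Reaches.mono (whileFind₃_reaches hn (forwardTest_expresses n) (pushForward_performs n)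
    (backwardTest_expresses n) (pushBackward_performs n)
    (relabelTest_expresses n) (relabelVertex_performs n) (Inv := I.FlowInv c)
    (Φ := fun σ => preflowPotential (n + 1) (flowOf n σ) (excessOf n σ) (labelOf n σ))
    (fun σ h => h.input.size)
    (fun σ u v hu hv h hR => h.of_forward (u := ⟨u, hu⟩) (v := ⟨v, hv⟩) hR)
    (fun σ u v hu hv h hR => h.of_backward (u := ⟨u, hu⟩) (v := ⟨v, hv⟩) hR)
    (fun σ u v _ hv h h1 h2 hR => h.of_relabel h1 h2 (v := ⟨v, hv⟩) hR) σ hc ?_) le_rfl ?_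
  · simpa [flowSteps] using preflowPotential_le (f := flowOf n σ.core) (g := excessOf n σ.core)
      hc.preflow.label_le
  · rintro τ ⟨h1, h2⟩
    refine ⟨c, h1, fun v hv => ?_⟩
    by_contra h0
    refine h2 v v v.2 v.2 ⟨hv, ?_⟩
    rw [h1.input.size]
    exact Nat.lt_succ_iff.1 (not_le.1 h0)

end BISInstance

/-! ### Correctness of the cut, the follower's choice and the output -/

namespace BISInstance

open AddRAM

variable {K : Type} [Field K] [LinearOrder K] [IsStrictOrderedRing K] {n : ℕ}
  {I : BISInstance K n}

/-! ### The cut -/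

variable (I) in
/-- All labels below the candidate for the unused label are used. -/
structure LabelInv (c : Fin n → Bool) (σ : State K) : Prop where
  input : I.IsInput σ
  clean : ∀ i, σ.nat 3 i = 0 ∧ σ.num 2 i = 0
  proper : ∀ a b, I.graph.Adj a b → c a ≠ c b
  colour : ∀ v : Fin n, σ.nat 4 v = if c v = true then 1 else 2
  preflow : IsPreflow (I.arc c) c I.effectiveWeight (n + 1) (flowOf n σ) (excessOf n σ)
    (labelOf n σ)
  maximal : ∀ v : Fin n, 0 < excessOf n σ v → n + 1 ≤ labelOf n σ v
  used : ∀ k < σ.nat 7 0, ∃ v, labelOf n σ v = k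

/-- The labels below the candidate belong to distinct vertices, of which there are `n`. -/
theorem LabelInv.le {c : Fin n → Bool} {σ : State K} (h : I.LabelInv c σ) : σ.nat 7 0 ≤ n := by
  have h1 : Finset.range (σ.nat 7 0) ⊆ Finset.univ.image (labelOf n σ) := by
    intro k hk
    obtain ⟨v, hv⟩ := h.used k (Finset.mem_range.1 hk)
    exact Finset.mem_image.2 ⟨v, Finset.mem_univ _, hv⟩
  simpa using (Finset.card_le_card h1).trans Finset.card_image_le

variable (I) in
/-- The vertices of `M` are marked by their colours and labels. -/
structure CutInv (M : Finset (Fin n)) (σ : State K) : Prop where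
  input : I.IsInput σ
  mem_iff : ∀ v : Fin n, v ∈ M ↔ v ∈ I.leader ∧
    (σ.nat 4 v ≤ 1 ∧ σ.nat 7 0 < σ.nat 5 v ∨ 1 < σ.nat 4 v ∧ σ.nat 5 v < σ.nat 7 0)

variable (I) in
/-- The output cells contain the set `O` and its weight. -/
structure OutputIs (O : Finset (Fin n)) (σ : State K) : Prop where
  indicator : ∀ v : Fin n, σ.nat 3 v = if v ∈ O then 1 else 0
  value : σ.num 2 0 = I.leaderObjective O

/-- The cut is heaviest in the whole graph for the effective weights. Dropping the follower's
vertices from it loses no effective weight, and on sets of leader vertices the two weights agree. -/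
theorem LabelInv.exists_cut {c : Fin n → Bool} {σ : State K} (h : I.LabelInv c σ)
    (hk : ∀ v : Fin n, labelOf n σ v ≠ σ.nat 7 0) :
    ∃ M, I.IsMaxWeightLeaderIndepSet M ∧ I.CutInv M σ := by
  classical
  set S : Finset (Fin n) := Finset.univ.filter (cutSide c (labelOf n σ) (σ.nat 7 0)) with hS
  have hmemS : ∀ v, v ∈ S ↔ cutSide c (labelOf n σ) (σ.nat 7 0) v := by simp [hS]
  have hkN : σ.nat 7 0 < n + 1 := Nat.lt_succ_of_le h.le
  have hobj : ∀ J : Finset (Fin n), ∑ v ∈ J, I.effectiveWeight v =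
      I.leaderObjective (J.filter (· ∈ I.leader)) := by
    intro J
    simp only [effectiveWeight, leaderObjective, Finset.sum_filter]
  refine ⟨S.filter (· ∈ I.leader), ⟨fun v hv => (Finset.mem_filter.1 hv).2, ?_, ?_⟩, h.input, ?_⟩
  · intro a ha b hb _ hab
    simp only [Finset.coe_filter, Set.mem_ofPred_eq, hmemS] at ha hb
    have key : ∀ a b, cutSide c (labelOf n σ) (σ.nat 7 0) a →
        cutSide c (labelOf n σ) (σ.nat 7 0) b → ¬ I.arc c a b := fun a b ha hb =>
      cutSide_independent (arc_colours h.proper) h.preflow.label_forward ha hb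
    have hcab := h.proper a b hab
    by_cases hca : c a = true
    · exact key a b ha.1 hb.1 ⟨hab, hca⟩
    · refine key b a hb.1 ha.1 ⟨hab.symm, ?_⟩
      cases hcb : c b <;> simp_all
  · intro J hJ hind
    have h1 := h.preflow.sum_le_cutSide (arc_colours h.proper) h.maximal hkN hk S J hmemS
      (fun a ha b hb hE => hind ha hb (arc_ne hE) hE.1)
    rw [hobj, hobj, Finset.filter_true_of_mem hJ] at h1
    exact h1
  · intro v
    have hv := h.colour v
    rw [Finset.mem_filter, hmemS, and_comm, cutSide]
    refine and_congr_right fun _ => ?_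
    cases hc : c v <;> simp [hc, hv, labelOf]

theorem findUnusedLabel_reaches (hn : 0 < n) (σ : State K)
    (hσ : ∃ c, I.FlowInv c σ.core ∧
      ∀ v : Fin n, 0 < excessOf n σ.core v → n + 1 ≤ labelOf n σ.core v) :
    Reaches findUnusedLabel σ (whileTime labelTest nextLabel n (n + 1))
      fun τ => ∃ M, I.IsMaxWeightLeaderIndepSet M ∧ I.CutInv M τ.core ∧ I.OutputIs ∅ τ.core := by
  obtain ⟨c, hc, hmax⟩ := hσ
  refine Reaches.mono (whileFind_reaches hn (labelTest_expresses n) (nextLabel_performs n)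
    (Inv := I.LabelInv c) (Φ := fun σ => n + 1 - σ.nat 7 0) (fun σ h => h.input.size) ?_ σ
    ⟨hc.input, fun i => ⟨(hc.clean i).1, (hc.clean i).2.2⟩, hc.proper, hc.colour, hc.preflow,
      hmax, by rw [(hc.clean 0).2.1]; simp⟩ (by omega))
    le_rfl ?_
  · rintro σ u v - hv h hR
    refine ⟨⟨h.input.writeNat (by omega) _ _, by simpa using h.clean, h.proper,
      by simpa using h.colour, h.preflow, h.maximal, fun k hk => ?_⟩, ?_⟩
    · simp only [State.nat_writeNat, and_self, if_true] at hk
      rcases Nat.lt_succ_iff_lt_or_eq.1 hk with hk | rfl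
      · exact h.used k hk
      · exact ⟨⟨v, hv⟩, hR⟩
    · have := h.le
      simp
      omega
  · rintro τ ⟨h1, h2⟩
    obtain ⟨M, hM, hcut⟩ := h1.exists_cut fun v => h2 v v v.2 v.2
    exact ⟨M, hM, hcut, fun v => by simpa using (h1.clean v).1,
      by simpa [leaderObjective] using (h1.clean 0).2⟩

/-! ### Output of a maximum weight independent set -/

theorem OutputIs.select {O : Finset (Fin n)} {σ : State K} (hin : I.IsInput σ)
    (h : I.OutputIs O σ) {v : Fin n} (hv : σ.nat 3 v = 0) :
    I.OutputIs (insert v O) (selectEffect σ v) := by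
  have hvO : v ∉ O := fun h0 => by
    have := h.indicator v
    rw [if_pos h0] at this
    omega
  refine ⟨fun u => ?_, ?_⟩
  · by_cases hu : u = v
    · subst hu; simp [selectEffect]
    · have hu' : (u : ℕ) ≠ v := fun h0 => hu (Fin.ext h0)
      simpa [selectEffect, hu, hu'] using h.indicator u
  · simp [selectEffect, leaderObjective, Finset.sum_insert hvO, h.value, hin.leaderWeight]
    ring

theorem selectCut_reaches (hn : 0 < n) {M : Finset (Fin n)} (σ : State K)
    (hcut : I.CutInv M σ.core) (hout : I.OutputIs ∅ σ.core) :
    Reaches selectCut σ (whileTime selectTest selectVertex n n)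
      fun τ => I.IsInput τ.core ∧ I.OutputIs M τ.core := by
  refine Reaches.mono (whileFind_reaches hn (selectTest_expresses n) (selectVertex_performs n)
    (Inv := fun σ => I.CutInv M σ ∧ ∃ O ⊆ M, I.OutputIs O σ)
    (Φ := fun σ => (Finset.univ.filter fun u : Fin n => σ.nat 3 u = 0).card)
    (fun σ h => h.1.input.size) ?_ σ ⟨hcut, ∅, by simp, hout⟩ (card_filter_le_size _)) le_rfl ?_
  · rintro σ u v - hv ⟨h, O, hO, hOut⟩ ⟨⟨hlead, hzero⟩, hside⟩
    have hvM : (⟨v, hv⟩ : Fin n) ∈ M :=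
      (h.mem_iff ⟨v, hv⟩).2 ⟨(h.input.leader ⟨v, hv⟩).1 hlead, hside⟩
    refine ⟨⟨⟨(h.input.writeNat (by omega) _ _).writeNum (by omega) _ _, fun w => ?_⟩,
      insert ⟨v, hv⟩ O, Finset.insert_subset hvM hO, hOut.select h.input (v := ⟨v, hv⟩) hzero⟩, ?_⟩
    · simpa [selectEffect] using h.mem_iff w
    · refine card_filter_lt_of_imp (v := ⟨v, hv⟩) (fun w hw => ?_) hzero (by simp [selectEffect])
      by_cases h0 : (w : ℕ) = v
      · simp [selectEffect, h0] at hw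
      · simpa [selectEffect, h0] using hw
  · rintro τ ⟨⟨h, O, hO, hOut⟩, hno⟩
    have : O = M := by
      refine hO.antisymm fun v hv => ?_
      by_contra hvO
      obtain ⟨h1, h2⟩ := (h.mem_iff v).1 hv
      refine hno v v v.2 v.2 ⟨⟨(h.input.leader v).2 h1, ?_⟩, h2⟩
      rw [hOut.indicator v, if_neg hvO]
    exact ⟨h.input, this ▸ hOut⟩

variable (I) in
/-- A maximum weight independent set of the leader, nonempty if possible, has been output. -/
def LeaderDone (M : Finset (Fin n)) (σ : State K) : Prop :=
  I.IsMaxWeightLeaderIndepSet M ∧ (I.leader.Nonempty → M.Nonempty) ∧ I.OutputIs M σ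

/-- If `∅` is of maximum weight, enlarging it cannot lose weight. -/
theorem isMaxWeightLeaderIndepSet_singleton (h : I.IsMaxWeightLeaderIndepSet ∅) {v : Fin n}
    (hv : v ∈ I.leader) : I.IsMaxWeightLeaderIndepSet {v} := by
  refine ⟨by simpa using hv, by simp, fun M' h1 h2 => (h.2.2 M' h1 h2).trans ?_⟩
  exact I.leaderObjective_mono (by simp)

theorem ensureNonempty_reaches (hn : 0 < n) {M : Finset (Fin n)}
    (hM : I.IsMaxWeightLeaderIndepSet M) (σ : State K)
    (hin : I.IsInput σ.core) (hout : I.OutputIs M σ.core) :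
    Reaches ensureNonempty σ (searchTime selectedTest n + 1 +
        (searchTime leaderTest n + selectVertex.ops + 1 + 10) + 10)
      fun τ => I.IsInput τ.core ∧ ∃ M, I.LeaderDone M τ.core := by
  refine firstOf_reaches hn (selectedTest_expresses n) (by simpa using hin.size) ?_ ?_
  · intro τ u v hc _ hv _ hR
    refine Reaches.of_run (P := .skip) trivial ?_
    rw [State.core_writeNat_search]
    simp only [Program.run]
    rw [hc]
    refine ⟨hin, M, hM, fun _ => ⟨⟨v, hv⟩, ?_⟩, hout⟩
    by_contra h0
    have := hout.indicator ⟨v, hv⟩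
    rw [if_neg h0] at this
    simp only at this
    omega
  · intro τ hc _ hno
    have hempty : M = ∅ := by
      refine Finset.eq_empty_of_forall_notMem fun v hv => hno v v v.2 v.2 ?_
      rw [hout.indicator v, if_pos hv]
    subst hempty
    refine firstOf_reaches hn (leaderTest_expresses n) (by
      have : τ.core.nat 0 0 = n := by rw [hc]; exact hin.size
      simpa using this) ?_ ?_
    · intro ρ u v hc' hu hv hat hR
      refine Reaches.of_run (selectVertex_performs (K := K) n).1 ?_
      rw [State.core_writeNat_search, (selectVertex_performs n).2 ρ u v hu hv hat, hc', hc]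
      rw [hc] at hR
      have hlead := (hin.leader ⟨v, hv⟩).1 hR
      refine ⟨(hin.writeNat (by omega) _ _).writeNum (by omega) _ _, {⟨v, hv⟩},
        isMaxWeightLeaderIndepSet_singleton hM hlead, fun _ => by simp, ?_⟩
      exact hout.select hin (v := ⟨v, hv⟩) (by rw [hout.indicator]; simp)
    · intro ρ hc' _ hno'
      refine Reaches.of_run (P := .skip) trivial ?_
      simp only [Program.run]
      rw [hc', hc]
      rw [hc] at hno'
      refine ⟨hin, ∅, hM, ?_, hout⟩
      rintro ⟨v, hv⟩
      exact absurd ((hin.leader v).2 hv) (hno' v v v.2 v.2)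

/-! ### The best vertex of the follower -/

/-- The follower prefers the vertex `v` to the vertex `b`. -/
def Better (I : BISInstance K n) (v b : Fin n) : Prop :=
  v ∉ I.leader ∧ (I.followerWeight v ≤ I.followerWeight b →
    I.followerWeight b ≤ I.followerWeight v ∧ I.leaderWeight v < I.leaderWeight b)

theorem Better.trans {u v b : Fin n} (h : I.Better u v) (h' : I.Better v b) : I.Better u b := by
  refine ⟨h.1, fun hub => ?_⟩
  rcases le_total (I.followerWeight v) (I.followerWeight b) with h1 | h1
  · obtain ⟨h2, h3⟩ := h'.2 h1
    obtain ⟨h4, h5⟩ := h.2 (hub.trans h2)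
    exact ⟨h2.trans h4, h5.trans h3⟩
  · obtain ⟨h4, h5⟩ := h.2 (hub.trans h1)
    obtain ⟨h2, h3⟩ := h'.2 (h4.trans hub)
    exact ⟨h2.trans h4, h5.trans h3⟩

theorem Better.irrefl (b : Fin n) : ¬ I.Better b b := fun h =>
  lt_irrefl _ (h.2 le_rfl).2

theorem isBestFollowerVertex_of_forall {b : Fin n} (hb : b ∉ I.leader)
    (h : ∀ v, ¬ I.Better v b) : I.IsBestFollowerVertex b := by
  refine ⟨hb, fun v hv => ?_, fun v hv hbv => ?_⟩
  · by_contra h0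
    exact h v ⟨hv, fun h1 => absurd h1 h0⟩
  · by_contra h0
    exact h v ⟨hv, fun _ => ⟨hbv, not_le.1 h0⟩⟩

theorem improveBest_reaches (hn : 0 < n) {M : Finset (Fin n)} (σ : State K)
    (hin : I.IsInput σ.core) (hM : I.LeaderDone M σ.core) {b : Fin n} (hb : b ∉ I.leader)
    (hσ : σ.core.nat 8 0 = b) :
    Reaches improveBest σ (whileTime betterTest setBest n n)
      fun τ => I.IsInput τ.core ∧ I.LeaderDone M τ.core ∧
        ∃ b, I.IsBestFollowerVertex b ∧ τ.core.nat 8 0 = b := by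
  classical
  have hRiff : ∀ (σ : State K) (b v : Fin n), I.IsInput σ → σ.nat 8 0 = b →
      ((¬ 1 ≤ σ.nat 2 v ∧ (σ.num 1 v ≤ σ.num 1 (σ.nat 8 0) →
        σ.num 1 (σ.nat 8 0) ≤ σ.num 1 v ∧ σ.num 0 v < σ.num 0 (σ.nat 8 0))) ↔ I.Better v b) := by
    intro σ b v hin hb
    rw [hb, hin.leader, hin.followerWeight, hin.followerWeight, hin.leaderWeight,
      hin.leaderWeight, Better]
  refine Reaches.mono (whileFind_reaches hn (betterTest_expresses n) (setBest_performs n)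
    (Inv := fun σ => I.IsInput σ ∧ I.LeaderDone M σ ∧ ∃ b, b ∉ I.leader ∧ σ.nat 8 0 = b)
    -- The number of vertices preferred to the current one falls because the preference is
    -- transitive and irreflexive.
    (Φ := fun σ => (Finset.univ.filter fun v : Fin n =>
      ∃ b : Fin n, σ.nat 8 0 = b ∧ I.Better v b).card)
    (fun σ h => h.1.size) ?_ σ ⟨hin, hM, b, hb, hσ⟩ (card_filter_le_size _)) le_rfl ?_
  · rintro σ u v - hv ⟨hin, hM, b, hb, hσb⟩ hR
    have hbet : I.Better ⟨v, hv⟩ b := (hRiff σ b ⟨v, hv⟩ hin hσb).1 hR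
    refine ⟨⟨hin.writeNat (by omega) _ _, ⟨hM.1, hM.2.1, fun w => ?_, ?_⟩, ⟨v, hv⟩, hbet.1, ?_⟩, ?_⟩
    · simpa using hM.2.2.indicator w
    · simpa using hM.2.2.value
    · simp
    · refine card_filter_lt_of_imp (v := ⟨v, hv⟩) ?_ ⟨b, hσb, hbet⟩ ?_
      · rintro w ⟨b', hb', hw⟩
        have : b' = ⟨v, hv⟩ := Fin.ext (by simpa using hb'.symm)
        subst this
        exact ⟨b, hσb, hw.trans hbet⟩
      · rintro ⟨b', hb', hw⟩
        have : b' = ⟨v, hv⟩ := Fin.ext (by simpa using hb'.symm)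
        subst this
        exact Better.irrefl _ hw
  · rintro τ ⟨⟨hin, hM, b, hb, hτ⟩, hno⟩
    exact ⟨hin, hM, b, isBestFollowerVertex_of_forall hb fun v hv =>
      hno v v v.2 v.2 ((hRiff τ.core b v hin hτ).2 hv), hτ⟩

theorem clearSelection_reaches (hn : 0 < n) (σ : State K) (hin : I.IsInput σ.core) (b : ℕ)
    (hσ : σ.core.nat 8 0 = b) :
    Reaches clearSelection σ (whileTime selectedTest unselect n n)
      fun τ => I.IsInput τ.core ∧ τ.core.nat 8 0 = b ∧ ∀ v : Fin n, τ.core.nat 3 v = 0 := by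
  refine Reaches.mono (whileFind_reaches hn (selectedTest_expresses n) (unselect_performs n)
    (Inv := fun σ => I.IsInput σ ∧ σ.nat 8 0 = b)
    (Φ := fun σ => (Finset.univ.filter fun v : Fin n => 1 ≤ σ.nat 3 v).card)
    (fun σ h => h.1.size) ?_ σ ⟨hin, hσ⟩ (card_filter_le_size _)) le_rfl ?_
  · rintro σ u v - hv ⟨hin, hσ⟩ hR
    refine ⟨⟨hin.writeNat (by omega) _ _, by simpa using hσ⟩, ?_⟩
    refine card_filter_lt_of_imp (v := ⟨v, hv⟩) (fun w hw => ?_) hR (by simp)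
    by_cases h0 : (w : ℕ) = v
    · simp [h0] at hw
    · simpa [h0] using hw
  · rintro τ ⟨⟨hin, hτ⟩, hno⟩
    refine ⟨hin, hτ, fun v => ?_⟩
    have := hno v v v.2 v.2
    omega

variable (I) in
def Solved (σ : State K) : Prop := ∃ L F : Finset (Fin n), I.IsOptimalSolution L F ∧
  I.OutputIs (L ∪ F) σ

/-- Ties go to the action `∅`. So `M` is kept only if it is strictly heavier than the nonnegative
leader weight of `b`, and is then nonempty. -/
theorem compareWithBest_reaches (hn : 0 < n) {M : Finset (Fin n)} (σ : State K)
    (hin : I.IsInput σ.core) (hM : I.LeaderDone M σ.core) {b : Fin n}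
    (hb : I.IsBestFollowerVertex b) (hσ : σ.core.nat 8 0 = b) :
    Reaches compareWithBest σ (20 + whileTime selectedTest unselect n n)
      fun τ => I.Solved τ.core := by
  refine Reaches.mono (Reaches.branch (T := whileTime selectedTest unselect n n + selectBest.ops)
    (T' := 1) (fun h => ?_) (fun h => ?_)) ?_ (fun _ h => h)
  · refine Reaches.seq (clearSelection_reaches hn σ hin b hσ) ?_
    rintro τ ⟨hin', hb', hzero⟩
    refine Reaches.of_run (by simp [selectBest, Program.LoopFree]) ?_
    rw [selectBest_run, hb']
    refine ⟨∅, {b}, hb.isOptimalSolution hM.1 ?_, fun v => ?_, ?_⟩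
    · rw [← hM.2.2.value, ← hin.leaderWeight, ← hσ]
      simpa [Test.Holds, NatExp.eval, NumExp.eval] using h
    · by_cases hv : v = b
      · subst hv; simp
      · have hv' : (v : ℕ) ≠ b := fun h0 => hv (Fin.ext h0)
        simpa [hv, hv'] using hzero v
    · simpa [leaderObjective] using hin'.leaderWeight b
  · refine Reaches.of_run (P := .skip) trivial ?_
    have hlt : I.leaderWeight b < I.leaderObjective M := by
      rw [← hM.2.2.value, ← hin.leaderWeight, ← hσ]
      simpa [Test.Holds, NatExp.eval, NumExp.eval] using h
    have hne : M.Nonempty := by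
      rw [Finset.nonempty_iff_ne_empty]
      rintro rfl
      have := I.leaderWeight_nonneg b
      simp [leaderObjective] at hlt
      linarith
    refine ⟨M, ∅, hM.1.isOptimalSolution hne fun b' hb' => ?_, by simpa [Program.run] using hM.2.2⟩
    rw [hb'.leaderWeight_eq hb]
    exact hlt.le
  · simp [Test.ops, NumExp.ops, NatExp.ops, Program.ops, selectBest]
    omega

theorem considerFollower_reaches (hn : 0 < n) (σ : State K) (hin : I.IsInput σ.core)
    (hM : ∃ M, I.LeaderDone M σ.core) :
    Reaches considerFollower σ (searchTime followerTest n + (setBest.ops +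
        (whileTime betterTest setBest n n + (20 + whileTime selectedTest unselect n n))) + 1 + 10)
      fun τ => I.Solved τ.core := by
  obtain ⟨M, hM⟩ := hM
  refine firstOf_reaches hn (followerTest_expresses n) (by simpa using hin.size) ?_ ?_
  · intro τ u v hc hu hv hat hR
    refine Reaches.seq (Q := fun ρ => I.IsInput ρ.core ∧ I.LeaderDone M ρ.core ∧
      ρ.core.nat 8 0 = v) (Reaches.of_run (P := setBest) trivial ?_) ?_
    · rw [(setBest_performs n).2 τ u v hu hv hat, hc]
      refine ⟨hin.writeNat (by omega) _ _, ⟨hM.1, hM.2.1, fun w => ?_, ?_⟩, by simp⟩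
      · simpa using hM.2.2.indicator w
      · simpa using hM.2.2.value
    · rintro ρ ⟨hin', hM', hρ⟩
      have hvl : (⟨v, hv⟩ : Fin n) ∉ I.leader := fun h0 => hR ((hin.leader ⟨v, hv⟩).2 h0)
      refine Reaches.seq (improveBest_reaches hn ρ hin' hM' hvl hρ) ?_
      rintro κ ⟨hin'', hM'', b, hb, hκ⟩
      refine Reaches.mono (compareWithBest_reaches hn κ hin'' hM'' hb hκ) le_rfl fun ξ hξ => ?_
      rwa [State.core_writeNat_search]
  · intro τ hc _ hno
    refine Reaches.of_run (P := .skip) trivial ?_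
    simp only [Program.run]
    rw [hc]
    -- Without follower vertices the action `∅` has no suitable reaction, and `0 < n` gives the
    -- leader a vertex, so `M` is nonempty.
    have hall : ∀ v, v ∈ I.leader := fun v =>
      (hin.leader v).1 (not_not.1 (hno v v v.2 v.2))
    exact ⟨M, ∅, hM.1.isOptimalSolution (hM.2.1 ⟨⟨0, hn⟩, hall _⟩)
      fun b hb => absurd (hall b) hb.notMem, by simpa using hM.2.2⟩

/-! ### The whole program -/

theorem encode_isInput (I : BISInstance K n) : I.IsInput I.encode := by
  refine ⟨by simp [encode], fun u v => ?_, fun v => ?_, fun v => ?_, fun v => ?_⟩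
  · have : (∃ u' v' : Fin n, (u : ℕ) * n + v = u' * n + v' ∧ I.graph.Adj u' v') ↔
        I.graph.Adj u v := by
      constructor
      · rintro ⟨u', v', h, hadj⟩
        obtain ⟨rfl, rfl⟩ := pair_index_inj.1 h
        exact hadj
      · exact fun h => ⟨u, v, rfl, h⟩
    rw [← this]
    simp only [encode, one_ne_zero, if_false, if_true]
    split_ifs with h
    · exact ⟨fun _ => h, fun _ => le_rfl⟩
    · exact ⟨fun h0 => absurd h0 (by omega), fun h0 => absurd h0 h⟩
  · have : (∃ v' ∈ I.leader, (v : ℕ) = (v' : ℕ)) ↔ v ∈ I.leader := by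
      constructor
      · rintro ⟨v', hv', h⟩
        rwa [Fin.ext h]
      · exact fun h => ⟨v, h, rfl⟩
    simp only [encode, this]
    by_cases h : v ∈ I.leader <;> simp [h]
  · simp [encode]
  · simp [encode]

theorem encode_core (I : BISInstance K n) : I.encode.core = I.encode := by
  simp only [State.core, encode, State.mk.injEq, and_true]
  funext a i
  split_ifs <;> simp_all

theorem encode_colouringInv (I : BISInstance K n) (hI : I.graph.IsBipartite) :
    ∃ c, I.ColouringInv c I.encode := by
  obtain ⟨C⟩ := hI
  refine ⟨fun v => decide (C v = 0), I.encode_isInput, fun i => by simp [encode], ?_,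
    fun v => Or.inl (by simp [encode])⟩
  intro a b hab
  have := C.valid hab
  simp only [ne_eq, decide_eq_decide]
  omega

def bilevelTime (n : ℕ) : ℕ :=
  whileTime₂ extendTest extendColour freshTest freshColour n n +
  (whileTime₃ forwardTest pushForward backwardTest pushBackward relabelTest relabelVertex n
    (flowSteps n) +
  (whileTime labelTest nextLabel n (n + 1) +
  (whileTime selectTest selectVertex n n +
  ((searchTime selectedTest n + 1 + (searchTime leaderTest n + selectVertex.ops + 1 + 10) + 10) +
  (searchTime followerTest n + (setBest.ops +
    (whileTime betterTest setBest n n + (20 + whileTime selectedTest unselect n n))) + 1 + 10)))))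

theorem solvedWithin_bilevelTime (I : BISInstance K n) (hn : 0 < n) (hI : I.graph.IsBipartite) :
    I.SolvedWithin bilevelProgram (unitCost K) (bilevelTime n) := by
  have h : Reaches bilevelProgram I.encode (bilevelTime n) fun τ => I.Solved τ.core := by
    refine Reaches.seq (colouring_reaches (I := I) hn I.encode ?_) ?_
    · rw [encode_core]; exact I.encode_colouringInv hI
    rintro σ ⟨⟨c, hc⟩, hcol⟩
    refine Reaches.seq (maximizeFlow_reaches hn σ ⟨c, hc.flowInv hcol⟩) ?_
    rintro σ hσ
    refine Reaches.seq (findUnusedLabel_reaches hn σ hσ) ?_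
    rintro σ ⟨M, hM, hcut, hout⟩
    refine Reaches.seq (selectCut_reaches hn σ hcut hout) ?_
    rintro σ ⟨hin, hout⟩
    refine Reaches.seq (ensureNonempty_reaches hn hM σ hin hout) ?_
    rintro σ ⟨hin, hM⟩
    exact considerFollower_reaches hn σ hin hM
  obtain ⟨τ, t, he, ht, L, F, hopt, hout⟩ := h
  exact ⟨τ, t, he, ht, L, F, hopt, fun v => by simpa using hout.indicator v,
    by simpa using hout.value⟩

/-- The function `T` is bounded by a polynomial. -/
def PolynomiallyBounded (T : ℕ → ℕ) : Prop := ∃ p : Polynomial ℕ, ∀ n, T n ≤ p.eval n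

theorem PolynomiallyBounded.const (c : ℕ) : PolynomiallyBounded fun _ => c :=
  ⟨Polynomial.C c, fun n => by simp⟩

theorem PolynomiallyBounded.id : PolynomiallyBounded fun n => n :=
  ⟨Polynomial.X, fun n => by simp⟩

theorem PolynomiallyBounded.add {S T : ℕ → ℕ} (hS : PolynomiallyBounded S)
    (hT : PolynomiallyBounded T) : PolynomiallyBounded fun n => S n + T n := by
  obtain ⟨p, hp⟩ := hS
  obtain ⟨q, hq⟩ := hT
  exact ⟨p + q, fun n => by simpa using Nat.add_le_add (hp n) (hq n)⟩

theorem PolynomiallyBounded.mul {S T : ℕ → ℕ} (hS : PolynomiallyBounded S)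
    (hT : PolynomiallyBounded T) : PolynomiallyBounded fun n => S n * T n := by
  obtain ⟨p, hp⟩ := hS
  obtain ⟨q, hq⟩ := hT
  exact ⟨p * q, fun n => by simpa using Nat.mul_le_mul (hp n) (hq n)⟩

/-- The `ops` of the fixed tests and actions are constants, so the bound is built from `n` and
constants by sums and products. -/
theorem polynomiallyBounded_bilevelTime : PolynomiallyBounded bilevelTime := by
  unfold bilevelTime whileTime₂ whileTime₃ whileTime searchTime flowSteps
  repeat' first
    | exact .const _
    | exact .id
    | apply PolynomiallyBounded.add
    | apply PolynomiallyBounded.mul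

end BISInstance

theorem mainTheorem8 :
    -- one program solves the problem on bipartite graphs in polynomial time
    (∃ P : AddRAM.Program,
      -- real weights: polynomially many arithmetic operations in the number of vertices
      (∃ p : Polynomial ℕ, ∀ (n : ℕ) (I : BISInstance ℝ n), 0 < n → I.graph.IsBipartite →
        I.SolvedWithin P (AddRAM.unitCost ℝ) (p.eval n)) ∧
      -- rational weights: polynomially many bit operations in the binary size of the input
      (∃ q : Polynomial ℕ, ∀ (n : ℕ) (I : BISInstance ℚ n), 0 < n → I.graph.IsBipartite →
        I.SolvedWithin P AddRAM.bitCost (q.eval I.bitLength))) ∧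
    -- the leader plays the empty set or a maximum weight independent set in her vertices
    (∀ (n : ℕ) (I : BISInstance ℝ n), 0 < n → I.graph.IsBipartite →
      (∀ L : Finset (Fin n), I.IsOptimalAction L → L = ∅ ∨ I.IsMaxWeightLeaderIndepSet L) ∧
      (∀ M : Finset (Fin n), M.Nonempty → I.IsMaxWeightLeaderIndepSet M →
        I.IsOptimalAction ∅ ∨ I.IsOptimalAction M)) := by
  obtain ⟨p, hp⟩ := BISInstance.polynomiallyBounded_bilevelTime
  -- Stated over every ordered field, so that one program and one polynomial serve both real and
  -- rational weights.
  have hsolve : ∀ {K : Type} [Field K] [LinearOrder K] [IsStrictOrderedRing K] (n : ℕ)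
      (I : BISInstance K n), 0 < n → I.graph.IsBipartite →
      I.SolvedWithin AddRAM.bilevelProgram (AddRAM.unitCost K) (p.eval n) := by
    intro K _ _ _ n I hn hI
    obtain ⟨τ, t, he, ht, hs⟩ := I.solvedWithin_bilevelTime hn hI
    exact ⟨τ, t, he, ht.trans (hp n), hs⟩
  exact ⟨⟨AddRAM.bilevelProgram, ⟨p, fun n I => hsolve n I⟩,
    BISInstance.exists_bitCost_bound _ p fun n I => hsolve n I⟩,
    fun n I _ _ => ⟨fun L hL => hL.eq_empty_or, fun M hne hM => hM.isOptimalAction_or hne⟩⟩
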